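/- Let $m, n_1,\dots,n_m$ be positive integers, $1<p<q<\infty$, $0<\beta_i<n_i$ and $\frac1q=\frac1p-\frac{\beta_i}{n_i}$ for $1\le i\le m$. For a real- or complex-valued $f\in L^p(\mathbb{R}^{n_1}\times\cdots\times\mathbb{R}^{n_m})$ put $$\mathscr{H}_{\beta_1,\dots,\beta_m}(f)(x)=\prod_{i=1}^m\frac{1}{|B(0,|x_i|)|^{1-\beta_i/n_i}}\int_{|y_1|<|x_1|}\cdots\int_{|y_m|<|x_m|}f(y_1,\dots,y_m)\,dy_1\cdots dy_m$$ for $x=(x_1,\dots,x_m)$ with all $x_i\ne0$, where $|B(0,r)|$ is the Lebesgue measure of the open Euclidean ball of radius $r$ in $\mathbb{R}^{n_i}$. Then $f$ is integrable on each of these products of balls, $\mathscr{H}_{\beta_1,\dots,\beta_m}(f)\in L^q(\mathbb{R}^{n_1}\times\cdots\times\mathbb{R}^{n_m})$ and $$\|\mathscr{H}_{\beta_1,\dots,\beta_m}(f)\|_{L^q}\le C\,\|f\|_{L^p},\qquad C=\prod_{i=1}^m\left(\frac{p'}{q}\right)^{1/q}\left(\frac{n_i}{q\beta_i}\,B\!\left(\frac{n_i}{q\beta_i},\frac{n_i}{q'\beta_i}\right)\right)^{-\beta_i/n_i},$$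 where $\frac1p+\frac1{p'}=\frac1q+\frac1{q'}=1$ and $B(z,w)=\int_0^1t^{z-1}(1-t)^{w-1}\,dt$. Moreover, the operator norm is exactly $$\|\mathscr{H}_{\beta_1,\dots,\beta_m}\|_{L^p\to L^q}=C,$$ and the supremum of $\|\mathscr{H}_{\beta_1,\dots,\beta_m}(f)\|_{L^q}/\|f\|_{L^p}$ over the non-negative $f\in L^p$ with $\|f\|_{L^p}\ne0$ is also $C$. -/

import Mathlib

open MeasureTheory
open scoped ENNReal

/-- The product space `ℝ^{n₁} × ⋯ × ℝ^{n_m}`; each factor carries the Euclidean norm and the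
product carries the product Lebesgue measure. -/
abbrev ProdSpace {m : ℕ} (n : Fin m → ℕ) : Type :=
  (i : Fin m) → EuclideanSpace ℝ (Fin (n i))

/-- The product of open balls `B(0,|x₁|) × ⋯ × B(0,|x_m|)`. -/
def polyBall {m : ℕ} {n : Fin m → ℕ} (x : ProdSpace n) : Set (ProdSpace n) :=
  Set.univ.pi fun i => Metric.ball (0 : EuclideanSpace ℝ (Fin (n i))) ‖x i‖

/-- The fractional Hardy type operator `ℋ_{β₁,…,β_m}`, on scalar-valued functions. -/
noncomputable def hardyOp {𝕜 : Type*} [RCLike 𝕜] {m : ℕ} {n : Fin m → ℕ} (β : Fin m → ℝ)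
    (f : ProdSpace n → 𝕜) (x : ProdSpace n) : 𝕜 :=
  (∏ i, 1 / (volume.real (Metric.ball (0 : EuclideanSpace ℝ (Fin (n i))) ‖x i‖)) ^
      (1 - β i / (n i : ℝ))) • ∫ y in polyBall x, f y

/-- The Euler beta function `B(z,w) = ∫₀¹ t^{z-1} (1-t)^{w-1} dt` for real `z, w > 0`. -/
noncomputable def eulerBeta (z w : ℝ) : ℝ :=
  ∫ t in (0 : ℝ)..1, t ^ (z - 1) * (1 - t) ^ (w - 1)

/-- The constant `∏ᵢ (p'/q)^{1/q} ((nᵢ/(qβᵢ)) B(nᵢ/(qβᵢ), nᵢ/(q'βᵢ)))^{-βᵢ/nᵢ}`. -/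
noncomputable def hardyConst {m : ℕ} (n : Fin m → ℕ) (β : Fin m → ℝ) (p q : ℝ) : ℝ :=
  ∏ i, (p.conjExponent / q) ^ (1 / q) *
    ((n i : ℝ) / (q * β i) *
      eulerBeta ((n i : ℝ) / (q * β i)) ((n i : ℝ) / (q.conjExponent * β i))) ^ (-(β i / (n i : ℝ)))

/-
The operator has a positive kernel which is a tensor product over the factors. As `p ≤ q`,
Minkowski's integral inequality shows that the `L^p → L^q` bound of a tensor product of kernels is
at most the product of the bounds of the factors, so the upper bound reduces to one factor. There
`x ↦ |B(0,|x|)|` pushes Lebesgue measure forward to Lebesgue measure on `(0, ∞)` and turns the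
estimate into Bliss' inequality: with `r = q β_i / n_i = q / p - 1` and `F` the distribution
function of the pushforward of `|f|`,
`∫ F^q x^(r-q) dx ≤ const * (∫ |f|^(q/(r+1)))^(r+1)`.
For the sharp constant, scale `f` so that the increasing map of `(s, ∞)` onto `(0, ∞)`, `F` being
positive exactly beyond `s`, transports `F^q x^(r-q) dx` onto `y^r (1 + y^r)^(-q/r) dy`. The
arithmetic-geometric mean inequality applied to this map, followed by Hölder's inequality, gives
the claim. Equality holds for the density `(1 + t^r)^(-(r+1)/r)`, for which the map is the
identity, and the tensor product of these extremal functions attains the norm.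
-/

section

open Function Set Filter Topology

section Minkowski

variable {X Y : Type*} [MeasurableSpace X] [MeasurableSpace Y] {μ : Measure X} {ν : Measure Y}
  {h : X → Y → ℝ≥0∞} {s t : ℝ}

lemma lintegral_lintegral_mul_le_of_holderConjugate [SFinite μ] [SFinite ν]
    (hst : s.HolderConjugate t) (hh : Measurable (uncurry h)) {g : X → ℝ≥0∞} (hg : Measurable g) :
    ∫⁻ x, (∫⁻ y, h x y ∂ν) * g x ∂μ ≤
      (∫⁻ y, (∫⁻ x, h x y ^ s ∂μ) ^ (1 / s) ∂ν) * (∫⁻ x, g x ^ t ∂μ) ^ (1 / t) :=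
  calc ∫⁻ x, (∫⁻ y, h x y ∂ν) * g x ∂μ
      = ∫⁻ x, ∫⁻ y, h x y * g x ∂ν ∂μ :=
        lintegral_congr fun _ => (lintegral_mul_const _ hh.of_uncurry_left).symm
    _ = ∫⁻ y, ∫⁻ x, h x y * g x ∂μ ∂ν :=
        lintegral_lintegral_swap (hh.mul (hg.comp measurable_fst)).aemeasurable
    _ ≤ ∫⁻ y, (∫⁻ x, h x y ^ s ∂μ) ^ (1 / s) * (∫⁻ x, g x ^ t ∂μ) ^ (1 / t) ∂ν :=
        lintegral_mono fun _ => ENNReal.lintegral_mul_le_Lp_mul_Lq μ hst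
          hh.of_uncurry_right.aemeasurable hg.aemeasurable
    _ = _ := lintegral_mul_const _ ((Measurable.lintegral_prod_left (hh.pow_const s)).pow_const _)

lemma rpow_one_div_mul_rpow_one_div (hst : s.HolderConjugate t) (a : ℝ≥0∞) :
    a ^ (1 / s) * a ^ (1 / t) = a := by
  rw [← ENNReal.rpow_add_of_nonneg _ _ hst.one_div_nonneg hst.symm.one_div_nonneg, one_div,
    one_div, hst.inv_add_inv_eq_one, ENNReal.rpow_one]

lemma le_rpow_of_le_mul_rpow (hst : s.HolderConjugate t) {a b : ℝ≥0∞} (ha : a ≠ ∞)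
    (h : a ≤ b * a ^ (1 / t)) : a ≤ b ^ s := by
  rcases eq_or_ne a 0 with rfl | ha0
  · exact zero_le
  rw [← ENNReal.rpow_inv_le_iff hst.pos, ← one_div]
  refine (ENNReal.mul_le_mul_iff_left (c := a ^ (1 / t)) ?_ ?_).1
    ((rpow_one_div_mul_rpow_one_div hst a).trans_le h)
  · simp [ha0, ha]
  · simp [ha0, ha]

lemma exists_measurable_le_lt_lintegral [SigmaFinite μ] {f : X → ℝ≥0∞} {c : ℝ≥0∞}
    (hc : c < ∫⁻ x, f x ∂μ) :
    ∃ g : X → ℝ≥0∞, Measurable g ∧ g ≤ f ∧ ∫⁻ x, g x ∂μ ≠ ∞ ∧ c < ∫⁻ x, g x ∂μ := by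
  simp_rw [lintegral_eq_nnreal, lt_iSup_iff] at hc
  obtain ⟨g₀, hg₀, hc⟩ := hc
  obtain ⟨g, hg, hfin, hlt⟩ := SimpleFunc.exists_lt_lintegral_simpleFunc_of_lt_lintegral
    (f := g₀) (hc.trans_eq (by rw [← SimpleFunc.lintegral_eq_lintegral]; rfl))
  exact ⟨_, g.measurable.coe_nnreal_ennreal,
    fun x => (ENNReal.coe_le_coe.2 (hg x)).trans (hg₀ x), hfin.ne, hlt⟩

theorem lintegral_rpow_lintegral_le [SigmaFinite μ] [SFinite ν] (hh : Measurable (uncurry h))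
    (hs : 1 ≤ s) :
    ∫⁻ x, (∫⁻ y, h x y ∂ν) ^ s ∂μ ≤ (∫⁻ y, (∫⁻ x, h x y ^ s ∂μ) ^ (1 / s) ∂ν) ^ s := by
  rcases hs.eq_or_lt with rfl | hs
  · simpa only [ENNReal.rpow_one, div_one] using (lintegral_lintegral_swap hh.aemeasurable).le
  by_contra! hlt
  obtain ⟨g, hg, hgle, hgfin, hglt⟩ := exists_measurable_le_lt_lintegral hlt
  have hst := Real.HolderConjugate.conjExponent hs
  set t := s.conjExponent
  refine hglt.not_ge (le_rpow_of_le_mul_rpow hst hgfin ?_)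
  calc ∫⁻ x, g x ∂μ
      = ∫⁻ x, g x ^ (1 / s) * g x ^ (1 / t) ∂μ := by
        simp_rw [rpow_one_div_mul_rpow_one_div hst]
    _ ≤ ∫⁻ x, (∫⁻ y, h x y ∂ν) * g x ^ (1 / t) ∂μ := by
        gcongr with x
        rw [one_div, ENNReal.rpow_inv_le_iff hst.pos]
        exact hgle x
    _ ≤ _ := lintegral_lintegral_mul_le_of_holderConjugate hst hh (hg.pow_const _)
    _ = _ := by simp_rw [← ENNReal.rpow_mul, one_div_mul_cancel hst.symm.ne_zero, ENNReal.rpow_one]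

end Minkowski

lemma lintegral_prod_mul_mul {Y Y' : Type*} [MeasurableSpace Y] [MeasurableSpace Y']
    {ν : Measure Y} {ν' : Measure Y'} [SFinite ν'] {k : Y → ℝ≥0∞} {k' : Y' → ℝ≥0∞}
    (hk : Measurable k) (hk' : Measurable k') {g : Y × Y' → ℝ≥0∞} (hg : Measurable g) :
    ∫⁻ y, k y.1 * k' y.2 * g y ∂(ν.prod ν') = ∫⁻ y, k y * ∫⁻ y', k' y' * g (y, y') ∂ν' ∂ν := by
  rw [lintegral_prod (fun y => k y.1 * k' y.2 * g y)
    (((hk.comp measurable_fst).mul (hk'.comp measurable_snd)).mul hg).aemeasurable]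
  refine lintegral_congr fun y => ?_
  simp_rw [mul_assoc]
  exact lintegral_const_mul _ (hk'.mul (hg.comp measurable_prodMk_left))

/-- The integral operator with non-negative kernel `K` is bounded from `L^p(ν)` to `L^q(μ)` with
norm at most `D ^ (1 / q)`. The bound is stated for `q`-th powers, so that it is multiplicative
under tensor products without taking roots. -/
def HasKernelBound {X Y : Type*} [MeasurableSpace X] [MeasurableSpace Y] (μ : Measure X)
    (ν : Measure Y) (p q : ℝ) (K : X → Y → ℝ≥0∞) (D : ℝ≥0∞) : Prop :=
  ∀ g : Y → ℝ≥0∞, Measurable g →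
    ∫⁻ x, (∫⁻ y, K x y * g y ∂ν) ^ q ∂μ ≤ D * (∫⁻ y, g y ^ p ∂ν) ^ (q / p)

namespace HasKernelBound

variable {X X' Y Y' : Type*} [MeasurableSpace X] [MeasurableSpace X'] [MeasurableSpace Y]
  [MeasurableSpace Y'] {μ : Measure X} {μ' : Measure X'} {ν : Measure Y} {ν' : Measure Y'}
  {p q : ℝ} {K : X → Y → ℝ≥0∞} {K' : X' → Y' → ℝ≥0∞} {D D' : ℝ≥0∞}

lemma of_measurePreserving {e : X' ≃ᵐ X} {e' : Y' ≃ᵐ Y} (he : MeasurePreserving e μ' μ)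
    (he' : MeasurePreserving e' ν' ν) (h : HasKernelBound μ' ν' p q (fun x y => K (e x) (e' y)) D) :
    HasKernelBound μ ν p q K D := by
  intro g hg
  rw [← he.lintegral_comp_emb e.measurableEmbedding, ← he'.lintegral_comp_emb
    e'.measurableEmbedding]
  simp_rw [← he'.lintegral_comp_emb e'.measurableEmbedding]
  exact h _ (hg.comp e'.measurable)

lemma lintegral_lintegral_rpow_le [SigmaFinite μ'] [SFinite ν] (hp : 0 < p) (hpq : p ≤ q)
    (h : HasKernelBound μ ν p q K D)
    {H : X' → Y → ℝ≥0∞} (hH : Measurable (uncurry H)) :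
    ∫⁻ x', ∫⁻ x, (∫⁻ y, K x y * H x' y ∂ν) ^ q ∂μ ∂μ' ≤
      D * (∫⁻ y, (∫⁻ x', H x' y ^ q ∂μ') ^ (p / q) ∂ν) ^ (q / p) :=
  calc ∫⁻ x', ∫⁻ x, (∫⁻ y, K x y * H x' y ∂ν) ^ q ∂μ ∂μ'
      ≤ ∫⁻ x', D * (∫⁻ y, H x' y ^ p ∂ν) ^ (q / p) ∂μ' :=
        lintegral_mono fun x' => h _ hH.of_uncurry_left
    _ = D * ∫⁻ x', (∫⁻ y, H x' y ^ p ∂ν) ^ (q / p) ∂μ' :=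
        lintegral_const_mul _ ((Measurable.lintegral_prod_right (hH.pow_const p)).pow_const _)
    _ ≤ D * (∫⁻ y, (∫⁻ x', (H x' y ^ p) ^ (q / p) ∂μ') ^ (1 / (q / p)) ∂ν) ^ (q / p) := by
        gcongr
        exact lintegral_rpow_lintegral_le (hH.pow_const p) ((one_le_div hp).2 hpq)
    _ = _ := by simp_rw [← ENNReal.rpow_mul, mul_div_cancel₀ _ hp.ne', one_div_div]

theorem prod [SFinite μ] [SigmaFinite μ'] [SFinite ν] [SFinite ν'] (hp : 0 < p) (hpq : p ≤ q)
    (hK : Measurable (uncurry K)) (hK' : Measurable (uncurry K'))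
    (h : HasKernelBound μ ν p q K D) (h' : HasKernelBound μ' ν' p q K' D') :
    HasKernelBound (μ.prod μ') (ν.prod ν') p q (fun x y => K x.1 y.1 * K' x.2 y.2) (D * D') := by
  intro g hg
  have hq : 0 < q := hp.trans_le hpq
  set H : X' → Y → ℝ≥0∞ := fun x' y => ∫⁻ y', K' x' y' * g (y, y') ∂ν'
  have hH : Measurable (uncurry H) := by
    refine Measurable.lintegral_prod_right
      (f := fun (z : X' × Y) (y' : Y') => K' z.1 y' * g (z.2, y')) ?_
    exact (hK'.comp (by fun_prop : Measurable fun w : (X' × Y) × Y' => (w.1.1, w.2))).mul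
      (hg.comp (by fun_prop : Measurable fun w : (X' × Y) × Y' => (w.1.2, w.2)))
  have hmeas : Measurable fun x : X × X' => (∫⁻ y, K x.1 y * H x.2 y ∂ν) ^ q := by
    refine Measurable.pow_const (Measurable.lintegral_prod_right
      (f := fun (z : X × X') (y : Y) => K z.1 y * H z.2 y) ?_) _
    exact (hK.comp (by fun_prop : Measurable fun w : (X × X') × Y => (w.1.1, w.2))).mul
      (hH.comp (by fun_prop : Measurable fun w : (X × X') × Y => (w.1.2, w.2)))
  simp_rw [lintegral_prod_mul_mul hK.of_uncurry_left hK'.of_uncurry_left hg]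
  rw [lintegral_prod_symm' _ hmeas]
  calc ∫⁻ x', ∫⁻ x, (∫⁻ y, K x y * H x' y ∂ν) ^ q ∂μ ∂μ'
      ≤ D * (∫⁻ y, (∫⁻ x', H x' y ^ q ∂μ') ^ (p / q) ∂ν) ^ (q / p) :=
        lintegral_lintegral_rpow_le hp hpq h hH
    _ ≤ D * (∫⁻ y, (D' * (∫⁻ y', g (y, y') ^ p ∂ν') ^ (q / p)) ^ (p / q) ∂ν) ^ (q / p) := by
        gcongr with y
        exact h' _ (hg.comp measurable_prodMk_left)
    _ = D * (D' ^ (p / q) * ∫⁻ y, ∫⁻ y', g (y, y') ^ p ∂ν' ∂ν) ^ (q / p) := by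
        simp_rw [ENNReal.mul_rpow_of_nonneg _ _ (div_nonneg hp.le hq.le), ← ENNReal.rpow_mul,
          div_mul_div_cancel₀ hp.ne', div_self hq.ne', ENNReal.rpow_one]
        rw [lintegral_const_mul _ (Measurable.lintegral_prod_right' (hg.pow_const p))]
    _ = D * D' * (∫⁻ y, g y ^ p ∂(ν.prod ν')) ^ (q / p) := by
        rw [ENNReal.mul_rpow_of_nonneg _ _ (div_nonneg hq.le hp.le), ← ENNReal.rpow_mul,
          div_mul_div_cancel₀ hq.ne', div_self hp.ne', ENNReal.rpow_one, mul_assoc,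
          lintegral_prod _ (hg.pow_const p).aemeasurable]

lemma pi_of_isEmpty {ι : Type*} [Fintype ι] [IsEmpty ι] {X Y : ι → Type*}
    [∀ i, MeasurableSpace (X i)] [∀ i, MeasurableSpace (Y i)] (μ : ∀ i, Measure (X i))
    (ν : ∀ i, Measure (Y i)) (hp : p ≠ 0) :
    HasKernelBound (Measure.pi μ) (Measure.pi ν) p q (fun _ _ => 1) 1 := by
  intro g hg
  rw [Measure.pi_of_empty μ isEmptyElim, Measure.pi_of_empty ν isEmptyElim]
  simp [lintegral_dirac' _ hg, lintegral_dirac' _ (hg.pow_const p), ← ENNReal.rpow_mul,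
    mul_div_cancel₀ _ hp]

theorem pi {m : ℕ} {X Y : Fin m → Type*} [∀ i, MeasurableSpace (X i)]
    [∀ i, MeasurableSpace (Y i)] {μ : ∀ i, Measure (X i)} {ν : ∀ i, Measure (Y i)}
    [∀ i, SigmaFinite (μ i)] [∀ i, SigmaFinite (ν i)] {K : ∀ i, X i → Y i → ℝ≥0∞}
    {D : Fin m → ℝ≥0∞} (hp : 0 < p) (hpq : p ≤ q) (hK : ∀ i, Measurable (uncurry (K i)))
    (h : ∀ i, HasKernelBound (μ i) (ν i) p q (K i) (D i)) :
    HasKernelBound (Measure.pi μ) (Measure.pi ν) p q (fun x y => ∏ i, K i (x i) (y i))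
      (∏ i, D i) := by
  induction m with
  | zero =>
    simp only [Finset.univ_eq_empty, Finset.prod_empty]
    exact pi_of_isEmpty μ ν hp.ne'
  | succ m ih =>
    have htail : Measurable (uncurry fun (x : ∀ i : Fin m, X i.succ) (y : ∀ i : Fin m, Y i.succ) =>
        ∏ i, K i.succ (x i) (y i)) :=
      Finset.measurable_prod _ fun i _ => (hK i.succ).comp
        (by fun_prop : Measurable fun z : (∀ i : Fin m, X i.succ) × ∀ i : Fin m, Y i.succ =>
          (z.1 i, z.2 i))
    refine of_measurePreserving (measurePreserving_piFinSuccAbove μ 0).symm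
      (measurePreserving_piFinSuccAbove ν 0).symm ?_
    simp_rw [Fin.prod_univ_succ]
    exact (h 0).prod (μ' := Measure.pi fun i : Fin m => μ i.succ)
      (ν' := Measure.pi fun i : Fin m => ν i.succ) hp hpq (hK 0) htail
      (ih (fun i => hK i.succ) fun i => h i.succ)

end HasKernelBound

theorem lintegral_pi_prod {m : ℕ} {E : Fin m → Type*} [∀ i, MeasurableSpace (E i)]
    (μ : ∀ i, Measure (E i)) [∀ i, SigmaFinite (μ i)] {f : ∀ i, E i → ℝ≥0∞}
    (hf : ∀ i, Measurable (f i)) :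
    ∫⁻ x, ∏ i, f i (x i) ∂Measure.pi μ = ∏ i, ∫⁻ x, f i x ∂μ i := by
  induction m with
  | zero => simp
  | succ m ih =>
    have htail : Measurable fun y : (∀ i : Fin m, E i.succ) => ∏ i, f i.succ (y i) :=
      Finset.measurable_prod _ fun i _ => (hf _).comp (measurable_pi_apply i)
    rw [← (measurePreserving_piFinSuccAbove μ 0).symm.lintegral_comp_emb
      (MeasurableEquiv.measurableEmbedding _)]
    simp_rw [Fin.prod_univ_succ]
    rw [← ih (fun i => μ i.succ) fun i => hf i.succ]
    exact lintegral_prod_mul (ν := Measure.pi fun i : Fin m => μ i.succ) (hf 0).aemeasurable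
      htail.aemeasurable

section Profile

variable {q r y : ℝ}

lemma bijOn_div_one_sub : BijOn (fun t : ℝ => t / (1 - t)) (Ioo 0 1) (Ioi 0) := by
  refine ⟨fun t ht => div_pos ht.1 (sub_pos.2 ht.2), fun t ht u hu h => ?_, fun x hx => ?_⟩
  · have := (div_eq_div_iff (sub_pos.2 ht.2).ne' (sub_pos.2 hu.2).ne').1 h
    linarith
  · rw [mem_Ioi] at hx
    refine ⟨x / (1 + x), ⟨by positivity, (div_lt_one (by positivity)).2 (by linarith)⟩, ?_⟩
    change x / (1 + x) / (1 - x / (1 + x)) = x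
    field_simp
    ring

lemma hasDerivAt_div_one_sub {t : ℝ} (ht : t < 1) :
    HasDerivAt (fun t : ℝ => t / (1 - t)) ((1 - t) ^ (-2 : ℝ)) t := by
  have hpos : 0 < 1 - t := sub_pos.2 ht
  refine ((hasDerivAt_id t).div ((hasDerivAt_id t).const_sub 1) hpos.ne').congr_deriv ?_
  rw [Real.rpow_neg hpos.le, Real.rpow_two]
  simp only [id]
  field_simp
  ring

theorem integral_Ioi_rpow_mul_one_add_rpow (a b : ℝ) :
    ∫ u in Ioi (0 : ℝ), u ^ (a - 1) * (1 + u) ^ (-(a + b)) = eulerBeta a b := by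
  rw [eulerBeta, intervalIntegral.integral_of_le zero_le_one, integral_Ioc_eq_integral_Ioo,
    ← bijOn_div_one_sub.image_eq, integral_image_eq_integral_abs_deriv_smul measurableSet_Ioo
      (fun t ht => (hasDerivAt_div_one_sub ht.2).hasDerivWithinAt) bijOn_div_one_sub.injOn]
  refine setIntegral_congr_fun measurableSet_Ioo fun t ⟨ht0, ht1⟩ => ?_
  have hpos : 0 < 1 - t := sub_pos.2 ht1
  have hone_add : 1 + t / (1 - t) = (1 - t) ^ (-1 : ℝ) := by
    rw [Real.rpow_neg_one]
    field_simp
    ring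
  have hone_sub_rpow : (1 - t) ^ (b - 1) =
      (1 - t) ^ (-(a - 1)) * (1 - t) ^ (-2 : ℝ) * (1 - t) ^ (-1 * -(a + b)) := by
    rw [← Real.rpow_add hpos, ← Real.rpow_add hpos]
    congr 1
    ring
  rw [smul_eq_mul, hone_add, hone_sub_rpow, abs_of_nonneg (by positivity),
    ← Real.rpow_mul hpos.le, Real.div_rpow ht0.le hpos.le, div_eq_mul_inv (t ^ _),
    ← Real.rpow_neg hpos.le]
  ring

/-- The integral `∫₀^∞ (1 + y^r)^(-q/r) dy`, which is the `p`-th power of the `L^p` norm of the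
extremal function of Bliss' inequality, `p = q / (r + 1)`. -/
noncomputable def blissMass (q r : ℝ) : ℝ := ∫ y in Ioi (0 : ℝ), (1 + y ^ r) ^ (-(q / r))

theorem blissMass_eq_eulerBeta (hr : 0 < r) :
    blissMass q r = 1 / r * eulerBeta (1 / r) ((q - 1) / r) := by
  rw [blissMass, ← integral_comp_rpow_Ioi _ (one_div_pos.2 hr).ne',
    ← integral_Ioi_rpow_mul_one_add_rpow, ← integral_const_mul]
  refine setIntegral_congr_fun measurableSet_Ioi fun u hu => ?_
  rw [smul_eq_mul, abs_of_pos (one_div_pos.2 hr), ← Real.rpow_mul (le_of_lt hu),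
    one_div_mul_cancel hr.ne', Real.rpow_one, mul_assoc, ← add_div, add_sub_cancel]

lemma one_add_rpow_pos (hy : 0 ≤ y) (r : ℝ) : 0 < 1 + y ^ r := by positivity

lemma continuousOn_one_add_rpow_rpow (hr : 0 ≤ r) (e : ℝ) :
    ContinuousOn (fun y : ℝ => (1 + y ^ r) ^ e) (Ici 0) := fun y hy =>
  ((continuousAt_const.add (Real.continuousAt_rpow_const y r (Or.inr hr))).rpow_const
    (Or.inl (one_add_rpow_pos hy r).ne')).continuousWithinAt

lemma integrableOn_one_add_rpow_rpow {e : ℝ} (hr : 0 < r) (he : 1 < r * e) :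
    IntegrableOn (fun y : ℝ => (1 + y ^ r) ^ (-e)) (Ioi 0) := by
  have he0 : 0 < e := pos_of_mul_pos_right (zero_lt_one.trans he) hr.le
  have hcont := continuousOn_one_add_rpow_rpow hr.le (-e)
  rw [← Ioc_union_Ioi_eq_Ioi zero_le_one, integrableOn_union]
  refine ⟨(hcont.mono Icc_subset_Ici_self).integrableOn_Icc.mono_set Ioc_subset_Icc_self,
    (integrableOn_Ioi_rpow_of_lt (a := -(r * e)) (by linarith) one_pos).mono'
      ((hcont.mono (Ioi_subset_Ici zero_le_one)).aestronglyMeasurable measurableSet_Ioi) ?_⟩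
  filter_upwards [ae_restrict_mem measurableSet_Ioi] with y hy
  have hy0 : 0 < y := zero_lt_one.trans hy
  rw [Real.norm_of_nonneg (by positivity), ← mul_neg, Real.rpow_mul hy0.le]
  exact Real.rpow_le_rpow_of_nonpos (by positivity) (by linarith) (by linarith)

lemma integrableOn_blissMass (hr : 0 < r) (hq : 1 < q) :
    IntegrableOn (fun y : ℝ => (1 + y ^ r) ^ (-(q / r))) (Ioi 0) :=
  integrableOn_one_add_rpow_rpow hr (by rwa [mul_div_cancel₀ _ hr.ne'])

lemma integrableOn_one_add_rpow_one_sub (hr : 0 < r) (hq : r + 1 < q) :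
    IntegrableOn (fun y : ℝ => (1 + y ^ r) ^ (1 - q / r)) (Ioi 0) := by
  simpa only [neg_sub] using integrableOn_one_add_rpow_rpow (e := q / r - 1) hr
    (by rw [mul_sub, mul_div_cancel₀ _ hr.ne']; linarith)

lemma rpow_mul_one_add_rpow_eq (hy : 0 ≤ y) :
    y ^ r * (1 + y ^ r) ^ (-(q / r)) =
      (1 + y ^ r) ^ (1 - q / r) - (1 + y ^ r) ^ (-(q / r)) := by
  rw [sub_eq_add_neg (1 : ℝ), Real.rpow_add (one_add_rpow_pos hy r), Real.rpow_one]
  ring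

lemma integrableOn_rpow_mul_one_add_rpow (hr : 0 < r) (hq : r + 1 < q) :
    IntegrableOn (fun y : ℝ => y ^ r * (1 + y ^ r) ^ (-(q / r))) (Ioi 0) :=
  ((integrableOn_one_add_rpow_one_sub hr hq).sub
    (integrableOn_blissMass hr (by linarith))).congr_fun
      (fun _ hy => (rpow_mul_one_add_rpow_eq (le_of_lt hy)).symm) measurableSet_Ioi

lemma blissMass_pos (hr : 0 < r) (hq : 1 < q) : 0 < blissMass q r := by
  have hpos (y : ℝ) (hy : y ∈ Ioi (0 : ℝ)) : 0 < (1 + y ^ r) ^ (-(q / r)) :=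
    Real.rpow_pos_of_pos (one_add_rpow_pos (le_of_lt hy) r) _
  refine (setIntegral_pos_iff_support_of_nonneg_ae ?_ (integrableOn_blissMass hr hq)).2 ?_
  · filter_upwards [ae_restrict_mem measurableSet_Ioi] with y hy using (hpos y hy).le
  · have hsupp : Ioi 0 ⊆ support fun y : ℝ => (1 + y ^ r) ^ (-(q / r)) :=
      fun y hy => (hpos y hy).ne'
    rw [inter_eq_right.2 hsupp, Real.volume_Ioi]
    exact ENNReal.zero_lt_top

lemma hasDerivAt_mul_one_add_rpow (hr : r ≠ 0) (hy : 0 < y) :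
    HasDerivAt (fun y : ℝ => y * (1 + y ^ r) ^ (1 - q / r))
      ((1 + y ^ r) ^ (-(q / r)) - (q - r - 1) * (y ^ r * (1 + y ^ r) ^ (-(q / r)))) y := by
  have hP := one_add_rpow_pos hy.le r
  have hadd : HasDerivAt (fun y : ℝ => 1 + y ^ r) (r * y ^ (r - 1)) y :=
    (Real.hasDerivAt_rpow_const (Or.inl hy.ne')).const_add 1
  refine ((hasDerivAt_id y).mul (hadd.rpow_const (p := 1 - q / r) (Or.inl hP.ne'))).congr_deriv ?_
  rw [show 1 - q / r - 1 = -(q / r) by ring, show 1 - q / r = 1 + -(q / r) by ring,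
    Real.rpow_add hP, Real.rpow_one, Real.rpow_sub_one hy.ne']
  simp only [id]
  field_simp
  ring

lemma tendsto_mul_one_add_rpow (hr : 0 < r) (hq : r + 1 < q) :
    Tendsto (fun y : ℝ => y * (1 + y ^ r) ^ (1 - q / r)) atTop (𝓝 0) := by
  refine tendsto_of_tendsto_of_tendsto_of_le_of_le' tendsto_const_nhds
    (tendsto_rpow_neg_atTop (y := q - r - 1) (by linarith)) ?_ ?_
  all_goals filter_upwards [eventually_gt_atTop 0] with y hy
  · positivity
  · calc y * (1 + y ^ r) ^ (1 - q / r) ≤ y * (y ^ r) ^ (1 - q / r) := by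
          gcongr ?_ * ?_
          refine Real.rpow_le_rpow_of_nonpos (by positivity) (by linarith) ?_
          rw [sub_nonpos, one_le_div hr]
          linarith
      _ = y ^ (-(q - r - 1)) := by
          rw [← Real.rpow_mul hy.le, mul_sub, mul_one, mul_div_cancel₀ _ hr.ne',
            ← Real.rpow_one_add' hy.le (by linarith)]
          congr 1
          ring

theorem integral_rpow_mul_one_add_rpow (hr : 0 < r) (hq : r + 1 < q) :
    ∫ y in Ioi (0 : ℝ), y ^ r * (1 + y ^ r) ^ (-(q / r)) = blissMass q r / (q - r - 1) := by
  have hint := integrableOn_blissMass (r := r) hr (by linarith : 1 < q)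
  have hint' := (integrableOn_rpow_mul_one_add_rpow hr hq).const_mul (q - r - 1)
  have hftc := integral_Ioi_of_hasDerivAt_of_tendsto
    (continuousWithinAt_id.mul (continuousOn_one_add_rpow_rpow hr.le (1 - q / r) 0 self_mem_Ici))
    (fun y hy => hasDerivAt_mul_one_add_rpow hr.ne' hy) (hint.sub hint')
    (tendsto_mul_one_add_rpow hr hq)
  rw [integral_sub hint hint', integral_const_mul, ← blissMass, Pi.mul_apply, id, zero_mul,
    sub_zero] at hftc
  rw [eq_div_iff (by linarith)]
  linarith

theorem integral_one_add_rpow_one_sub (hr : 0 < r) (hq : r + 1 < q) :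
    ∫ y in Ioi (0 : ℝ), (1 + y ^ r) ^ (1 - q / r) =
      blissMass q r * ((q - r) / (q - r - 1)) := by
  have h := integral_rpow_mul_one_add_rpow hr hq
  rw [setIntegral_congr_fun measurableSet_Ioi fun y hy => rpow_mul_one_add_rpow_eq (le_of_lt hy),
    integral_sub (integrableOn_one_add_rpow_one_sub hr hq)
      (integrableOn_blissMass hr (by linarith)), ← blissMass] at h
  have : q - r - 1 ≠ 0 := by linarith
  rw [sub_eq_iff_eq_add.1 h]
  field_simp
  ring

end Profile

section Primitive

variable {a w : ℝ → ℝ} {s u x y : ℝ}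

lemma intervalIntegrable_of_integrableOn_Ioi (ha : IntegrableOn a (Ioi s)) (hx : s ≤ x)
    (hy : s ≤ y) : IntervalIntegrable a volume x y :=
  intervalIntegrable_iff.2 (ha.mono_set fun _ ht => (le_min hx hy).trans_lt ht.1)

lemma hasDerivAt_primitive (ha : IntegrableOn a (Ioi s)) (hac : ContinuousOn a (Ioi s))
    (hx : s < x) : HasDerivAt (fun x => ∫ t in s..x, a t) (a x) x :=
  intervalIntegral.integral_hasDerivAt_right
    (intervalIntegrable_of_integrableOn_Ioi ha le_rfl hx.le)
    (hac.stronglyMeasurableAtFilter isOpen_Ioi x hx) (hac.continuousAt (Ioi_mem_nhds hx))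

lemma strictMonoOn_primitive (ha : IntegrableOn a (Ioi s)) (hpos : ∀ t ∈ Ioi s, 0 < a t) :
    StrictMonoOn (fun x => ∫ t in s..x, a t) (Ici s) := by
  intro x hx y hy hxy
  rw [← sub_pos, intervalIntegral.integral_interval_sub_left
    (intervalIntegrable_of_integrableOn_Ioi ha le_rfl hy)
    (intervalIntegrable_of_integrableOn_Ioi ha le_rfl hx)]
  exact intervalIntegral.intervalIntegral_pos_of_pos_on
    (intervalIntegrable_of_integrableOn_Ioi ha hx hy)
    (fun t ht => hpos t (lt_of_le_of_lt hx ht.1)) hxy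

lemma primitive_le_integral_Ioi (ha : IntegrableOn a (Ioi s)) (hpos : ∀ t ∈ Ioi s, 0 ≤ a t)
    (hx : s ≤ x) : ∫ t in s..x, a t ≤ ∫ t in Ioi s, a t := by
  rw [intervalIntegral.integral_of_le hx]
  refine setIntegral_mono_set ha ?_ Ioc_subset_Ioi_self.eventuallyLE
  filter_upwards [ae_restrict_mem measurableSet_Ioi] with t ht using hpos t ht

lemma surjOn_primitive (ha : IntegrableOn a (Ioi s)) :
    SurjOn (fun x => ∫ t in s..x, a t) (Ioi s) (Ioo 0 (∫ t in Ioi s, a t)) := by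
  rintro v ⟨hv0, hv⟩
  obtain ⟨X, hsX, hX⟩ := ((eventually_gt_atTop s).and
    ((intervalIntegral_tendsto_integral_Ioi s ha tendsto_id).eventually_const_lt hv)).exists
  have hcont : ContinuousOn (fun x => ∫ t in s..x, a t) (Icc s X) := by
    rw [← uIcc_of_le hsX.le]
    refine intervalIntegral.continuousOn_primitive_interval ?_
    rw [uIcc_of_le hsX.le, integrableOn_Icc_iff_integrableOn_Ioc]
    exact ha.mono_set Ioc_subset_Ioi_self
  obtain ⟨x, ⟨hsx, -⟩, rfl⟩ := intermediate_value_Icc hsX.le hcont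
    ⟨by rw [intervalIntegral.integral_same]; exact hv0.le, hX.le⟩
  exact ⟨x, hsx.lt_of_ne (by rintro rfl; simp at hv0), rfl⟩

lemma bijOn_primitive (ha : IntegrableOn a (Ioi s)) (hpos : ∀ t ∈ Ioi s, 0 < a t) :
    BijOn (fun x => ∫ t in s..x, a t) (Ioi s) (Ioo 0 (∫ t in Ioi s, a t)) := by
  have hmono := strictMonoOn_primitive ha hpos
  refine ⟨fun x (hx : s < x) => ⟨?_, ?_⟩, (hmono.mono Ioi_subset_Ici_self).injOn,
    surjOn_primitive ha⟩
  · simpa using hmono self_mem_Ici hx.le hx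
  · have hx' : x < x + 1 := lt_add_one x
    exact (hmono hx.le (hx.le.trans hx'.le) hx').trans_le
      (primitive_le_integral_Ioi ha (fun t ht => (hpos t ht).le) (hx.le.trans hx'.le))

lemma exists_inverse_primitive (hw : IntegrableOn w (Ioi u)) (hwc : ContinuousOn w (Ioi u))
    (hpos : ∀ t ∈ Ioi u, 0 < w t) :
    ∃ b : ℝ → ℝ, BijOn b (Ioo 0 (∫ t in Ioi u, w t)) (Ioi u) ∧
      MonotoneOn b (Ioo 0 (∫ t in Ioi u, w t)) ∧
      ∀ v ∈ Ioo 0 (∫ t in Ioi u, w t), HasDerivAt b (w (b v))⁻¹ v := by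
  set B : ℝ → ℝ := fun y => ∫ t in u..y, w t
  have hB : BijOn B (Ioi u) _ := bijOn_primitive hw hpos
  have hinv := hB.invOn_invFunOn
  have hb := hB.symm hinv.symm
  have hmono : MonotoneOn (invFunOn B (Ioi u)) (Ioo 0 (∫ t in Ioi u, w t)) := by
    intro v hv v' hv' hvv'
    rw [← ((strictMonoOn_primitive hw hpos).mono Ioi_subset_Ici_self).le_iff_le
      (hb.mapsTo hv) (hb.mapsTo hv')]
    exact (hinv.2 hv).trans_le (hvv'.trans_eq (hinv.2 hv').symm)
  refine ⟨_, hb, hmono, fun v hv => ?_⟩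
  have hv_nhds := Ioo_mem_nhds hv.1 hv.2
  refine HasDerivAt.of_local_left_inverse (continuousAt_of_monotoneOn_of_image_mem_nhds hmono
    hv_nhds ?_) (hasDerivAt_primitive hw hwc (hb.mapsTo hv)) (hpos _ (hb.mapsTo hv)).ne' ?_
  · rw [hb.image_eq]
    exact Ioi_mem_nhds (hb.mapsTo hv)
  · filter_upwards [hv_nhds] with v' hv' using hinv.2 hv'

theorem exists_monotone_transport (ha : IntegrableOn a (Ioi s)) (hac : ContinuousOn a (Ioi s))
    (hapos : ∀ t ∈ Ioi s, 0 < a t) (hw : IntegrableOn w (Ioi u)) (hwc : ContinuousOn w (Ioi u))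
    (hwpos : ∀ t ∈ Ioi u, 0 < w t) (hmass : ∫ t in Ioi s, a t = ∫ t in Ioi u, w t) :
    ∃ T : ℝ → ℝ, BijOn T (Ioi s) (Ioi u) ∧ MonotoneOn T (Ioi s) ∧
      ∀ x ∈ Ioi s, HasDerivAt T (a x / w (T x)) x := by
  obtain ⟨b, hb, hbmono, hbderiv⟩ := exists_inverse_primitive hw hwc hwpos
  have hA := bijOn_primitive ha hapos
  rw [hmass] at hA
  refine ⟨b ∘ fun x => ∫ t in s..x, a t, hb.comp hA, hbmono.comp
    ((strictMonoOn_primitive ha hapos).monotoneOn.mono Ioi_subset_Ici_self) hA.mapsTo,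
    fun x hx => ?_⟩
  refine ((hbderiv _ (hA.mapsTo hx)).comp x (hasDerivAt_primitive ha hac hx)).congr_deriv ?_
  rw [div_eq_inv_mul, comp_apply]

end Primitive

section BlissTransport

variable {q r s x : ℝ} {F T : ℝ → ℝ}

/-- `T` is the increasing map of `(s, ∞)` onto `(0, ∞)` that transports the density
`F^q x^(r - q)` to the density `y^r (1 + y^r)^(-q/r)` of the extremal case of Bliss' inequality. -/
structure IsBlissTransport (q r s : ℝ) (F T : ℝ → ℝ) : Prop where
  bijOn : BijOn T (Ioi s) (Ioi 0)
  monotoneOn : MonotoneOn T (Ioi s)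
  hasDerivAt : ∀ x ∈ Ioi s,
    HasDerivAt T (F x ^ q * x ^ (-(q - r)) / (T x ^ r * (1 + T x ^ r) ^ (-(q / r)))) x

/-- The decreasing weight associated with a transport map `T`. The exponents are those that turn
the arithmetic-geometric mean inequality for the two terms of its derivative into an equality for
the extremal function, where `T` is the identity up to scaling. -/
noncomputable def blissWeight (q r : ℝ) (T : ℝ → ℝ) (x : ℝ) : ℝ :=
  x ^ (-(q - r) * ((q - r - 1) / q)) * T x ^ (-r * ((q - r - 1) / q))

lemma mul_rpow_le_am_gm (hr : 0 < r) (hq : r + 1 < q) {f t P T' : ℝ} (hf : 0 < f) (hx : 0 < x)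
    (ht : 0 < t) (hP : 0 < P) (hT' : T' = f ^ q * x ^ (-(q - r)) / (t ^ r * P ^ (-(q / r)))) :
    T' * P ^ (1 - q / r) ≤ f ^ (q - r) *
      ((q - r) / q * (x ^ (-(q - r) * ((q - r - 1) / q) - 1) * t ^ (-r * ((q - r - 1) / q))) +
        r / q * (x ^ (-(q - r) * ((q - r - 1) / q)) * t ^ (-r * ((q - r - 1) / q) - 1) * T')) := by
  have hq0 : 0 < q := by linarith
  have hT'0 : 0 < T' := by rw [hT']; positivity
  have hgm := Real.geom_mean_le_arith_mean2_weighted (w₁ := (q - r) / q) (w₂ := r / q)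
    (p₁ := x ^ (-(q - r) * ((q - r - 1) / q) - 1) * t ^ (-r * ((q - r - 1) / q)))
    (p₂ := x ^ (-(q - r) * ((q - r - 1) / q)) * t ^ (-r * ((q - r - 1) / q) - 1) * T')
    (div_nonneg (by linarith) hq0.le) (by positivity) (by positivity) (by positivity)
    (by field_simp; ring)
  refine le_trans (le_of_eq ?_) (mul_le_mul_of_nonneg_left hgm (by positivity))
  -- In logarithmic coordinates the claimed equality is linear.
  obtain ⟨f, rfl⟩ : ∃ c, f = Real.exp c := ⟨_, (Real.exp_log hf).symm⟩
  obtain ⟨x, rfl⟩ : ∃ c, x = Real.exp c := ⟨_, (Real.exp_log hx).symm⟩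
  obtain ⟨t, rfl⟩ : ∃ c, t = Real.exp c := ⟨_, (Real.exp_log ht).symm⟩
  obtain ⟨P, rfl⟩ : ∃ c, P = Real.exp c := ⟨_, (Real.exp_log hP).symm⟩
  rw [hT']
  simp only [← Real.exp_mul, ← Real.exp_add, ← Real.exp_sub]
  congr 1
  field_simp
  ring

lemma mul_rpow_eq_blissWeight_rpow (hr : 0 < r) (hq : r + 1 < q) {f P : ℝ} (hf : 0 < f)
    (hx : 0 < x) (ht : 0 < T x) (hP : 0 < P) :
    f ^ q * x ^ (-(q - r)) / (T x ^ r * P ^ (-(q / r))) * P ^ (-(q / r)) =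
      (f ^ (q - r - 1) * blissWeight q r T x) ^ (q / (q - r - 1)) := by
  have hq0 : 0 < q := by linarith
  have hq1 : 0 < q - r - 1 := by linarith
  rw [blissWeight]
  generalize T x = t at ht
  obtain ⟨f, rfl⟩ : ∃ c, f = Real.exp c := ⟨_, (Real.exp_log hf).symm⟩
  obtain ⟨x, rfl⟩ : ∃ c, x = Real.exp c := ⟨_, (Real.exp_log hx).symm⟩
  obtain ⟨t, rfl⟩ : ∃ c, t = Real.exp c := ⟨_, (Real.exp_log ht).symm⟩
  obtain ⟨P, rfl⟩ : ∃ c, P = Real.exp c := ⟨_, (Real.exp_log hP).symm⟩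
  simp only [← Real.exp_mul, ← Real.exp_add, ← Real.exp_sub]
  congr 1
  field_simp
  ring

theorem exists_isBlissTransport (hr : 0 < r) (hq : r + 1 < q) (hs : 0 ≤ s)
    (hF : ContinuousOn F (Ioi s)) (hFpos : ∀ x ∈ Ioi s, 0 < F x)
    (hFi : IntegrableOn (fun x => F x ^ q * x ^ (-(q - r))) (Ioi s))
    (hmass : ∫ x in Ioi s, F x ^ q * x ^ (-(q - r)) = blissMass q r / (q - r - 1)) :
    ∃ T, IsBlissTransport q r s F T := by
  have hpos {x : ℝ} (hx : x ∈ Ioi s) : 0 < x := hs.trans_lt hx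
  obtain ⟨T, hbij, hmono, hderiv⟩ := exists_monotone_transport hFi
    ((hF.rpow_const fun x hx => Or.inl (hFpos x hx).ne').mul
      (continuousOn_id.rpow_const fun x hx => Or.inl (hpos hx).ne'))
    (fun x hx => mul_pos (Real.rpow_pos_of_pos (hFpos x hx) _) (Real.rpow_pos_of_pos (hpos hx) _))
    (integrableOn_rpow_mul_one_add_rpow hr hq)
    ((Real.continuous_rpow_const hr.le).continuousOn.mul
      ((continuousOn_one_add_rpow_rpow hr.le _).mono Ioi_subset_Ici_self))
    (fun y hy => mul_pos (Real.rpow_pos_of_pos hy _)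
      (Real.rpow_pos_of_pos (one_add_rpow_pos (le_of_lt hy) r) _))
    (hmass.trans (integral_rpow_mul_one_add_rpow hr hq).symm)
  exact ⟨T, hbij, hmono, hderiv⟩

namespace IsBlissTransport

lemma pos (hT : IsBlissTransport q r s F T) (hx : x ∈ Ioi s) : 0 < T x := hT.bijOn.mapsTo hx

lemma lintegral_Ioi (hT : IsBlissTransport q r s F T) (g : ℝ → ℝ≥0∞) :
    ∫⁻ y in Ioi 0, g y = ∫⁻ x in Ioi s,
      ENNReal.ofReal (F x ^ q * x ^ (-(q - r)) / (T x ^ r * (1 + T x ^ r) ^ (-(q / r)))) *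
        g (T x) := by
  rw [← hT.bijOn.image_eq]
  exact lintegral_image_eq_lintegral_deriv_mul_of_monotoneOn measurableSet_Ioi
    (fun x hx => (hT.hasDerivAt x hx).hasDerivWithinAt) hT.monotoneOn g

lemma blissWeight_pos (hT : IsBlissTransport q r s F T) (hs : 0 ≤ s) (hx : x ∈ Ioi s) :
    0 < blissWeight q r T x :=
  mul_pos (Real.rpow_pos_of_pos (hs.trans_lt hx) _) (Real.rpow_pos_of_pos (hT.pos hx) _)

lemma antitoneOn_blissWeight (hT : IsBlissTransport q r s F T) (hr : 0 ≤ r) (hq : r + 1 < q)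
    (hs : 0 ≤ s) : AntitoneOn (blissWeight q r T) (Ioi s) := by
  intro x hx y hy hxy
  have hx0 : 0 < x := hs.trans_lt hx
  have hc : 0 ≤ (q - r - 1) / q := div_nonneg (by linarith) (by linarith)
  refine mul_le_mul
    (Real.rpow_le_rpow_of_nonpos hx0 hxy (mul_nonpos_of_nonpos_of_nonneg (by linarith) hc))
    (Real.rpow_le_rpow_of_nonpos (hT.pos hx) (hT.monotoneOn hx hy hxy)
      (mul_nonpos_of_nonpos_of_nonneg (by linarith) hc))
    (Real.rpow_nonneg (hT.pos hy).le _) (Real.rpow_nonneg hx0.le _)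

lemma hasDerivAt_blissWeight (hT : IsBlissTransport q r s F T) (hs : 0 ≤ s) (hx : x ∈ Ioi s) :
    HasDerivAt (blissWeight q r T)
      (-(q - r) * ((q - r - 1) / q) * x ^ (-(q - r) * ((q - r - 1) / q) - 1) *
          T x ^ (-r * ((q - r - 1) / q)) +
        x ^ (-(q - r) * ((q - r - 1) / q)) *
          (F x ^ q * x ^ (-(q - r)) / (T x ^ r * (1 + T x ^ r) ^ (-(q / r))) *
            (-r * ((q - r - 1) / q)) * T x ^ (-r * ((q - r - 1) / q) - 1))) x :=
  (Real.hasDerivAt_rpow_const (Or.inl (hs.trans_lt hx).ne')).mul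
    ((hT.hasDerivAt x hx).rpow_const (Or.inl (hT.pos hx).ne'))

theorem ofReal_le_lintegral_deriv_blissWeight (hT : IsBlissTransport q r s F T) (hr : 0 < r)
    (hq : r + 1 < q) (hs : 0 ≤ s) (hF : ∀ x ∈ Ioi s, 0 < F x) :
    ENNReal.ofReal (blissMass q r * ((q - r) / (q - r - 1))) ≤
      ∫⁻ x in Ioi s, ENNReal.ofReal (F x ^ (q - r)) *
        ENNReal.ofReal (1 / (q - r - 1) * -deriv (blissWeight q r T) x) := by
  have hq1 : 0 < q - r - 1 := by linarith
  have hq0 : 0 < q := by linarith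
  rw [← integral_one_add_rpow_one_sub hr hq, ofReal_integral_eq_lintegral_ofReal
    (integrableOn_one_add_rpow_one_sub hr hq), hT.lintegral_Ioi]
  · refine setLIntegral_mono' measurableSet_Ioi fun x hx => ?_
    have hx0 : 0 < x := hs.trans_lt hx
    have hT0 := hT.pos hx
    have hF0 := hF x hx
    rw [← ENNReal.ofReal_mul (by positivity), ← ENNReal.ofReal_mul (by positivity)]
    refine ENNReal.ofReal_le_ofReal
      ((mul_rpow_le_am_gm hr hq hF0 hx0 hT0 (one_add_rpow_pos hT0.le r) rfl).trans_eq ?_)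
    rw [(hT.hasDerivAt_blissWeight hs hx).deriv]
    field_simp
    ring
  · filter_upwards [ae_restrict_mem measurableSet_Ioi] with y hy
    exact (Real.rpow_pos_of_pos (one_add_rpow_pos (le_of_lt hy) r) _).le

theorem lintegral_blissWeight_rpow (hT : IsBlissTransport q r s F T) (hr : 0 < r)
    (hq : r + 1 < q) (hs : 0 ≤ s) (hF : ∀ x ∈ Ioi s, 0 < F x) :
    ∫⁻ x in Ioi s, ENNReal.ofReal ((F x ^ (q - r - 1) * blissWeight q r T x) ^ (q / (q - r - 1))) =
      ENNReal.ofReal (blissMass q r) := by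
  rw [blissMass, ofReal_integral_eq_lintegral_ofReal
    (integrableOn_blissMass hr (by linarith)), hT.lintegral_Ioi]
  · refine setLIntegral_congr_fun measurableSet_Ioi fun x hx => ?_
    have hx0 : 0 < x := hs.trans_lt hx
    have hT0 := hT.pos hx
    have hF0 := hF x hx
    rw [← ENNReal.ofReal_mul (by positivity),
      mul_rpow_eq_blissWeight_rpow hr hq hF0 hx0 hT0 (one_add_rpow_pos hT0.le r)]
  · filter_upwards [ae_restrict_mem measurableSet_Ioi] with y hy
    exact (Real.rpow_pos_of_pos (one_add_rpow_pos (le_of_lt hy) r) _).le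

end IsBlissTransport

end BlissTransport

section DistributionFunction

lemma measure_measure_Iio_le (ν : Measure ℝ) [IsFiniteMeasure ν] [NullSingletonClass ν]
    (u : ℝ≥0∞) : ν {t | ν (Iio t) ≤ u} ≤ u := by
  have hm : Measurable fun t => ν (Iio t) :=
    Monotone.measurable fun _ _ h => measure_mono (Iio_subset_Iio h)
  rw [(measurableSet_le hm measurable_const).measure_eq_iSup_isCompact ν]
  refine iSup₂_le fun K hK => iSup_le fun hKc => ?_
  rcases K.eq_empty_or_nonempty with rfl | hne
  · simp
  obtain ⟨k, hk, hmax⟩ := hKc.exists_isGreatest hne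
  calc ν K ≤ ν (Iic k) := measure_mono fun t ht => hmax ht
    _ = ν (Iio k) := (measure_congr Iio_ae_eq_Iic).symm
    _ ≤ u := hK hk

lemma ofReal_sub_le_measure_lt_measureReal_Iio (ν : Measure ℝ) [IsFiniteMeasure ν]
    [NullSingletonClass ν] {u : ℝ} (hu : 0 ≤ u) :
    ENNReal.ofReal (ν.real univ - u) ≤ ν {t | u < ν.real (Iio t)} := by
  have hm : Measurable fun t => ν.real (Iio t) :=
    Monotone.measurable fun _ _ h => measureReal_mono (Iio_subset_Iio h)
  have hcompl : {t | u < ν.real (Iio t)}ᶜ ⊆ {t | ν (Iio t) ≤ ENNReal.ofReal u} := by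
    intro t ht
    rw [mem_ofPred_eq, ← ofReal_measureReal]
    exact ENNReal.ofReal_le_ofReal (not_lt.1 ht)
  rw [ENNReal.ofReal_sub _ hu, ofReal_measureReal, tsub_le_iff_right]
  calc ν univ = ν {t | u < ν.real (Iio t)} + ν {t | u < ν.real (Iio t)}ᶜ :=
        (measure_add_measure_compl (measurableSet_lt measurable_const hm)).symm
    _ ≤ ν {t | u < ν.real (Iio t)} + ENNReal.ofReal u := by
        gcongr
        exact (measure_mono hcompl).trans (measure_measure_Iio_le ν _)

lemma lintegral_Ioc_rpow_sub_one {γ c : ℝ} (hγ : 0 < γ) (hc : 0 ≤ c) :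
    ∫⁻ t in Ioc 0 c, ENNReal.ofReal (t ^ (γ - 1)) = ENNReal.ofReal (c ^ γ / γ) := by
  rw [← ofReal_integral_eq_lintegral_ofReal, ← intervalIntegral.integral_of_le hc,
    integral_rpow (Or.inl (by linarith)), sub_add_cancel, Real.zero_rpow hγ.ne', sub_zero]
  · exact (intervalIntegral.intervalIntegrable_rpow' (by linarith)).1
  · filter_upwards [ae_restrict_mem measurableSet_Ioc] with t ht
    exact Real.rpow_nonneg ht.1.le _

-- By the layer cake formula it suffices to compare the distribution of `F t = ν (Iio t)` under `ν`
-- with Lebesgue measure on `(0, ν univ]`.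
theorem rpow_measureReal_univ_le_lintegral (ν : Measure ℝ) [IsFiniteMeasure ν]
    [NullSingletonClass ν] {γ : ℝ} (hγ : 1 < γ) :
    ENNReal.ofReal (ν.real univ ^ γ) ≤
      ENNReal.ofReal γ * ∫⁻ t, ENNReal.ofReal (ν.real (Iio t) ^ (γ - 1)) ∂ν := by
  have hm : Measurable fun t => ν.real (Iio t) :=
    Monotone.measurable fun _ _ h => measureReal_mono (Iio_subset_Iio h)
  have hle : ∫⁻ t in Ioc 0 (ν.real univ), ENNReal.ofReal (t ^ (γ - 1)) ≤
      ∫⁻ t, ENNReal.ofReal (ν.real (Iio t) ^ (γ - 1)) ∂ν := by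
    rw [lintegral_rpow_eq_lintegral_meas_lt_mul ν (ae_of_all _ fun t => measureReal_nonneg)
      hm.aemeasurable (sub_pos.2 hγ), lintegral_rpow_eq_lintegral_meas_lt_mul (f := fun t => t) _
      (by filter_upwards [ae_restrict_mem measurableSet_Ioc] with t ht using ht.1.le)
      aemeasurable_id (sub_pos.2 hγ)]
    gcongr _ * ?_
    refine setLIntegral_mono' measurableSet_Ioi fun u hu => ?_
    refine mul_le_mul_left ?_ _
    calc (volume.restrict (Ioc 0 (ν.real univ))) {a | u < a}
        ≤ volume (Ioc u (ν.real univ)) := by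
          rw [Measure.restrict_apply (measurableSet_lt measurable_const measurable_id')]
          exact measure_mono fun t ht => ⟨ht.1, ht.2.2⟩
      _ = ENNReal.ofReal (ν.real univ - u) := Real.volume_Ioc
      _ ≤ ν {t | u < ν.real (Iio t)} :=
          ofReal_sub_le_measure_lt_measureReal_Iio ν (le_of_lt hu)
  have hγ0 : 0 < γ := one_pos.trans hγ
  calc ENNReal.ofReal (ν.real univ ^ γ)
      = ENNReal.ofReal γ * ENNReal.ofReal (ν.real univ ^ γ / γ) := by
        rw [← ENNReal.ofReal_mul hγ0.le, mul_div_cancel₀ _ hγ0.ne']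
    _ ≤ _ := by
        rw [← lintegral_Ioc_rpow_sub_one hγ0 measureReal_nonneg]
        gcongr

lemma rpow_measureReal_Iio_le_lintegral (ν : Measure ℝ) [IsFiniteMeasure ν]
    [NullSingletonClass ν] {γ : ℝ} (hγ : 1 < γ) (x : ℝ) :
    ENNReal.ofReal (ν.real (Iio x) ^ γ) ≤
      ENNReal.ofReal γ * ∫⁻ t in Iio x, ENNReal.ofReal (ν.real (Iio t) ^ (γ - 1)) ∂ν := by
  have h := rpow_measureReal_univ_le_lintegral (ν.restrict (Iio x)) hγ
  rw [measureReal_restrict_apply_univ] at h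
  refine h.trans_eq ?_
  congr 1
  refine setLIntegral_congr_fun measurableSet_Iio fun t ht => ?_
  rw [measureReal_restrict_apply measurableSet_Iio, Iio_inter_Iio, min_eq_left (le_of_lt ht)]

lemma lintegral_setLIntegral_Iio_mul (μ ν : Measure ℝ) [SFinite μ] [SFinite ν]
    {g h : ℝ → ℝ≥0∞} (hg : Measurable g) (hh : Measurable h) :
    ∫⁻ x, (∫⁻ t in Iio x, g t ∂ν) * h x ∂μ = ∫⁻ t, g t * ∫⁻ x in Ioi t, h x ∂μ ∂ν := by
  have hmeas : Measurable (uncurry fun x t : ℝ => (Iio x).indicator g t * h x) :=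
    ((hg.comp measurable_snd).indicator (measurableSet_lt measurable_snd measurable_fst)).mul
      (hh.comp measurable_fst)
  calc ∫⁻ x, (∫⁻ t in Iio x, g t ∂ν) * h x ∂μ
      = ∫⁻ x, ∫⁻ t, (Iio x).indicator g t * h x ∂ν ∂μ := by
        refine lintegral_congr fun x => ?_
        rw [lintegral_mul_const _ (hg.indicator measurableSet_Iio),
          lintegral_indicator measurableSet_Iio]
    _ = ∫⁻ t, ∫⁻ x, (Iio x).indicator g t * h x ∂μ ∂ν :=
        lintegral_lintegral_swap hmeas.aemeasurable
    _ = ∫⁻ t, g t * ∫⁻ x in Ioi t, h x ∂μ ∂ν := by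
        refine lintegral_congr fun t => ?_
        rw [← lintegral_indicator measurableSet_Ioi,
          ← lintegral_const_mul _ (hh.indicator measurableSet_Ioi)]
        refine lintegral_congr fun x => ?_
        by_cases hx : t < x <;> simp [hx]

lemma setLIntegral_Ioi_neg_deriv_le {φ : ℝ → ℝ} {t : ℝ} (hφ : AntitoneOn φ (Ici t))
    (hφ0 : ∀ x ∈ Ioi t, 0 ≤ φ x) (hφd : ∀ x ∈ Ioi t, DifferentiableAt ℝ φ x) :
    ∫⁻ x in Ioi t, ENNReal.ofReal (-deriv φ x) ≤ ENNReal.ofReal (φ t) := by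
  rw [lintegral_deriv_eq_volume_image_of_antitoneOn measurableSet_Ioi
    (fun x hx => (hφd x hx).hasDerivAt.hasDerivWithinAt) (hφ.mono Ioi_subset_Ici_self),
    ← sub_zero (φ t), ← Real.volume_Icc]
  refine measure_mono ?_
  rintro _ ⟨x, hx, rfl⟩
  exact ⟨hφ0 x hx, hφ self_mem_Ici (Ioi_subset_Ici_self hx) (le_of_lt hx)⟩

theorem lintegral_rpow_measureReal_Iio_mul_neg_deriv_le (ν : Measure ℝ) [IsFiniteMeasure ν]
    [NullSingletonClass ν] {γ s : ℝ} {φ : ℝ → ℝ} (hγ : 1 < γ) (hνs : ν.real (Iio s) = 0)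
    (hφ : AntitoneOn φ (Ioi s)) (hφ0 : ∀ x ∈ Ioi s, 0 ≤ φ x)
    (hφd : ∀ x ∈ Ioi s, DifferentiableAt ℝ φ x) :
    ∫⁻ x in Ioi s, ENNReal.ofReal (ν.real (Iio x) ^ γ) * ENNReal.ofReal (-deriv φ x) ≤
      ENNReal.ofReal γ * ∫⁻ t in Ioi s, ENNReal.ofReal (ν.real (Iio t) ^ (γ - 1) * φ t) ∂ν := by
  have hF : Monotone fun t => ν.real (Iio t) := fun _ _ h => measureReal_mono (Iio_subset_Iio h)
  have hdm : Measurable fun x => ENNReal.ofReal (-deriv φ x) :=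
    (measurable_deriv φ).neg.ennreal_ofReal
  have htail : ∀ t ∈ Ioi s, ∫⁻ x in Ioi t, ENNReal.ofReal (-deriv φ x) ∂volume.restrict (Ioi s) ≤
      ENNReal.ofReal (φ t) := fun t ht => by
    have hsub : Ici t ⊆ Ioi s := Ici_subset_Ioi.2 ht
    rw [Measure.restrict_restrict measurableSet_Ioi,
      inter_eq_left.2 (Ioi_subset_Ici_self.trans hsub)]
    exact setLIntegral_Ioi_neg_deriv_le (hφ.mono hsub)
      (fun x hx => hφ0 x (hsub (Ioi_subset_Ici_self hx)))
      fun x hx => hφd x (hsub (Ioi_subset_Ici_self hx))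
  calc ∫⁻ x in Ioi s, ENNReal.ofReal (ν.real (Iio x) ^ γ) * ENNReal.ofReal (-deriv φ x)
      ≤ ∫⁻ x in Ioi s, ENNReal.ofReal γ *
          ((∫⁻ t in Iio x, ENNReal.ofReal (ν.real (Iio t) ^ (γ - 1)) ∂ν) *
            ENNReal.ofReal (-deriv φ x)) := by
        refine lintegral_mono fun x => ?_
        rw [← mul_assoc]
        exact mul_le_mul_left (rpow_measureReal_Iio_le_lintegral ν hγ x) _
    _ = ENNReal.ofReal γ * ∫⁻ t, ENNReal.ofReal (ν.real (Iio t) ^ (γ - 1)) *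
          ∫⁻ x in Ioi t, ENNReal.ofReal (-deriv φ x) ∂volume.restrict (Ioi s) ∂ν := by
        rw [lintegral_const_mul' _ _ ENNReal.ofReal_ne_top, lintegral_setLIntegral_Iio_mul _ _
          (hF.measurable.pow_const _).ennreal_ofReal hdm]
    _ ≤ _ := by
        refine mul_le_mul_right ?_ _
        rw [← lintegral_indicator measurableSet_Ioi]
        refine lintegral_mono fun t => ?_
        by_cases ht : t ∈ Ioi s
        · rw [indicator_of_mem ht, ENNReal.ofReal_mul (Real.rpow_nonneg measureReal_nonneg _)]
          gcongr
          exact htail t ht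
        · have ht0 : ν.real (Iio t) = 0 :=
            le_antisymm ((hF (not_lt.1 ht)).trans_eq hνs) measureReal_nonneg
          simp [ht0, Real.zero_rpow (sub_pos.2 hγ).ne']

theorem IsBlissTransport.ofReal_blissMass_le_lintegral {q r s : ℝ} {T : ℝ → ℝ} (ν : Measure ℝ)
    [IsFiniteMeasure ν] [NullSingletonClass ν]
    (hT : IsBlissTransport q r s (fun x => ν.real (Iio x)) T) (hr : 0 < r) (hq : r + 1 < q)
    (hs : 0 ≤ s) (hνs : ν.real (Iio s) = 0) (hpos : ∀ x ∈ Ioi s, 0 < ν.real (Iio x)) :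
    ENNReal.ofReal (blissMass q r) ≤ ∫⁻ t in Ioi s,
      ENNReal.ofReal (ν.real (Iio t) ^ (q - r - 1) * blissWeight q r T t) ∂ν := by
  have hq1 : 0 < q - r - 1 := by linarith
  have hc : 0 < (q - r) / (q - r - 1) := div_pos (by linarith) hq1
  have hparts := lintegral_rpow_measureReal_Iio_mul_neg_deriv_le ν (γ := q - r) (by linarith) hνs
    (hT.antitoneOn_blissWeight hr.le hq hs) (fun x hx => (hT.blissWeight_pos hs hx).le)
    fun x hx => (hT.hasDerivAt_blissWeight hs hx).differentiableAt
  rw [← ENNReal.mul_le_mul_iff_right (ENNReal.ofReal_pos.2 hc).ne' ENNReal.ofReal_ne_top]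
  calc ENNReal.ofReal ((q - r) / (q - r - 1)) * ENNReal.ofReal (blissMass q r)
      = ENNReal.ofReal (blissMass q r * ((q - r) / (q - r - 1))) := by
        rw [← ENNReal.ofReal_mul hc.le, mul_comm]
    _ ≤ ∫⁻ x in Ioi s, ENNReal.ofReal (ν.real (Iio x) ^ (q - r)) *
          ENNReal.ofReal (1 / (q - r - 1) * -deriv (blissWeight q r T) x) :=
        hT.ofReal_le_lintegral_deriv_blissWeight hr hq hs hpos
    _ = ENNReal.ofReal (1 / (q - r - 1)) * ∫⁻ x in Ioi s,
          ENNReal.ofReal (ν.real (Iio x) ^ (q - r)) *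
            ENNReal.ofReal (-deriv (blissWeight q r T) x) := by
        rw [← lintegral_const_mul' _ _ ENNReal.ofReal_ne_top]
        refine lintegral_congr fun x => ?_
        rw [ENNReal.ofReal_mul (by positivity), mul_left_comm]
    _ ≤ ENNReal.ofReal (1 / (q - r - 1)) * (ENNReal.ofReal (q - r) * ∫⁻ t in Ioi s,
          ENNReal.ofReal (ν.real (Iio t) ^ (q - r - 1) * blissWeight q r T t) ∂ν) := by
        gcongr
    _ = _ := by
        rw [← mul_assoc, ← ENNReal.ofReal_mul (by positivity), one_div_mul_eq_div]

end DistributionFunction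

section BlissEnergy

/-- The left-hand side of Bliss' inequality for a measure `ν` on the half-line: the weighted
`L^q` norm, to the power `q`, of its distribution function. -/
noncomputable def blissEnergy (q r : ℝ) (ν : Measure ℝ) : ℝ≥0∞ :=
  ∫⁻ t in Ioi 0, ν (Iio t) ^ q * ENNReal.ofReal (t ^ (-(q - r)))

variable {q r s t : ℝ} {F : ℝ → ℝ} {ν : Measure ℝ} {M : NNReal}

lemma blissEnergy_smul (hq : 0 ≤ q) (r : ℝ) (ν : Measure ℝ) {c : ℝ≥0∞} (hc : c ≠ ∞) :
    blissEnergy q r (c • ν) = c ^ q * blissEnergy q r ν := by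
  simp only [blissEnergy, Measure.smul_apply, smul_eq_mul, ENNReal.mul_rpow_of_nonneg _ _ hq,
    mul_assoc]
  exact lintegral_const_mul' _ _ (ENNReal.rpow_ne_top_of_nonneg hq hc)

lemma measurable_blissEnergy_integrand (q r : ℝ) (ν : Measure ℝ) :
    Measurable fun t => ν (Iio t) ^ q * ENNReal.ofReal (t ^ (-(q - r))) := by
  have hm : Measurable fun t => ν (Iio t) :=
    Monotone.measurable fun _ _ h => measure_mono (Iio_subset_Iio h)
  exact (hm.pow_const q).mul (by fun_prop)

lemma tendsto_blissEnergy (hq : 0 ≤ q) (r : ℝ) {νs : ℕ → Measure ℝ} (hmono : Monotone νs)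
    (hlim : ∀ t, Tendsto (fun k => νs k (Iio t)) atTop (𝓝 (ν (Iio t)))) :
    Tendsto (fun k => blissEnergy q r (νs k)) atTop (𝓝 (blissEnergy q r ν)) := by
  refine lintegral_tendsto_of_tendsto_of_monotone
    (fun k => (measurable_blissEnergy_integrand q r (νs k)).aemeasurable)
    (ae_of_all _ fun t k l hkl => ?_) (ae_of_all _ fun t => ?_)
  · have := hmono hkl (Iio t)
    dsimp only
    gcongr
  · exact ENNReal.Tendsto.mul_const ((ENNReal.continuous_rpow_const.tendsto _).comp (hlim t))
      (Or.inr ENNReal.ofReal_ne_top)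

lemma integrableOn_rpow_mul_rpow_of_le {c : ℝ} (hr : 0 ≤ r) (hq : r + 1 < q)
    (hF : Continuous F) (hF0 : ∀ t, 0 ≤ F t) (hFM : ∀ t, 0 ≤ t → F t ≤ M * t)
    (hFc : ∀ t, F t ≤ c) : IntegrableOn (fun t => F t ^ q * t ^ (-(q - r))) (Ioi 0) := by
  have hq0 : 0 ≤ q := by linarith
  have hcont : ContinuousOn (fun t => F t ^ q * t ^ (-(q - r))) (Ioi 0) :=
    (hF.continuousOn.rpow_const fun _ _ => Or.inr hq0).mul
      (continuousOn_id.rpow_const fun x hx => Or.inl (ne_of_gt hx))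
  have hnorm {t : ℝ} (ht : 0 < t) :
      ‖F t ^ q * t ^ (-(q - r))‖ = F t ^ q * t ^ (-(q - r)) :=
    Real.norm_of_nonneg (mul_nonneg (Real.rpow_nonneg (hF0 t) _) (Real.rpow_nonneg ht.le _))
  rw [← Ioc_union_Ioi_eq_Ioi zero_le_one, integrableOn_union]
  constructor
  · refine Integrable.mono' (g := fun _ => (M : ℝ) ^ q) (integrable_const _)
      ((hcont.mono Ioc_subset_Ioi_self).aestronglyMeasurable measurableSet_Ioc) ?_
    filter_upwards [ae_restrict_mem measurableSet_Ioc] with t ht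
    rw [hnorm ht.1]
    calc F t ^ q * t ^ (-(q - r)) ≤ (M * t) ^ q * t ^ (-(q - r)) :=
          mul_le_mul_of_nonneg_right (Real.rpow_le_rpow (hF0 t) (hFM t ht.1.le) hq0)
            (Real.rpow_nonneg ht.1.le _)
      _ = M ^ q * t ^ r := by
          rw [Real.mul_rpow M.coe_nonneg ht.1.le, mul_assoc, ← Real.rpow_add ht.1]
          congr 2; ring
      _ ≤ M ^ q := mul_le_of_le_one_right (by positivity) (Real.rpow_le_one ht.1.le ht.2 hr)
  · refine Integrable.mono' (g := fun t => c ^ q * t ^ (-(q - r)))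
      ((integrableOn_Ioi_rpow_of_lt (by linarith) one_pos).const_mul _)
      ((hcont.mono (Ioi_subset_Ioi zero_le_one)).aestronglyMeasurable measurableSet_Ioi) ?_
    filter_upwards [ae_restrict_mem measurableSet_Ioi] with t ht
    have ht0 : (0 : ℝ) < t := one_pos.trans ht
    rw [hnorm ht0]
    exact mul_le_mul_of_nonneg_right (Real.rpow_le_rpow (hF0 t) (hFc t) hq0)
      (Real.rpow_nonneg ht0.le _)

lemma exists_eq_zero_forall_Ioi_pos (hF : Continuous F) (hmono : Monotone F) (h0 : F 0 = 0)
    (ht : 0 < F t) : ∃ s, 0 ≤ s ∧ F s = 0 ∧ ∀ x ∈ Ioi s, 0 < F x := by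
  have hbdd : BddAbove {x | F x ≤ 0} :=
    ⟨t, fun x hx => le_of_lt (hmono.reflect_lt (lt_of_le_of_lt hx ht))⟩
  have hmem := (isClosed_le hF continuous_const).csSup_mem ⟨0, h0.le⟩ hbdd
  have hs : 0 ≤ sSup {x | F x ≤ 0} := le_csSup hbdd h0.le
  exact ⟨_, hs, le_antisymm hmem (h0.symm.trans_le (hmono hs)),
    fun x hx => not_le.1 (notMem_of_csSup_lt (s := {x | F x ≤ 0}) hx hbdd)⟩

lemma nullSingletonClass_of_le_smul_volume (hν : ν ≤ M • volume) : NullSingletonClass ν :=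
  ⟨fun x => le_antisymm ((hν {x}).trans_eq (by simp)) zero_le⟩

lemma measureReal_Iio_le_add (hν : ν ≤ M • volume) (hst : s ≤ t) :
    ν.real (Iio t) ≤ ν.real (Iio s) + M * (t - s) := by
  have hIco : ν.real (Ico s t) ≤ M * (t - s) := by
    refine ENNReal.toReal_le_of_le_ofReal (mul_nonneg M.coe_nonneg (sub_nonneg.2 hst)) ?_
    refine (hν _).trans_eq ?_
    rw [Measure.smul_apply, Real.volume_Ico, ENNReal.ofReal_mul M.coe_nonneg,
      ENNReal.ofReal_coe_nnreal]
    rfl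
  rw [← Iio_union_Ico_eq_Iio hst]
  exact (measureReal_union_le _ _).trans (by gcongr)

variable [IsFiniteMeasure ν]

lemma continuous_measureReal_Iio (hν : ν ≤ M • volume) : Continuous fun t => ν.real (Iio t) := by
  refine (LipschitzWith.of_le_add_mul M fun x y => ?_).continuous
  rcases le_total x y with h | h
  · exact (measureReal_mono (Iio_subset_Iio h)).trans (le_add_of_nonneg_right (by positivity))
  · rw [Real.dist_eq, abs_of_nonneg (sub_nonneg.2 h)]
    exact measureReal_Iio_le_add hν h

lemma integrableOn_measureReal_Iio_rpow_mul_rpow (hr : 0 ≤ r) (hq : r + 1 < q)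
    (hν : ν ≤ M • volume) (hν0 : ν (Iio 0) = 0) :
    IntegrableOn (fun t => ν.real (Iio t) ^ q * t ^ (-(q - r))) (Ioi 0) := by
  refine integrableOn_rpow_mul_rpow_of_le (M := M) (c := ν.real univ) hr hq
    (continuous_measureReal_Iio hν) (fun t => measureReal_nonneg) (fun t ht => ?_)
    fun t => measureReal_mono (subset_univ _)
  simpa [measureReal_def, hν0] using measureReal_Iio_le_add hν ht

lemma blissEnergy_eq_lintegral_ofReal (hq : 0 ≤ q) (r : ℝ) (ν : Measure ℝ) [IsFiniteMeasure ν] :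
    blissEnergy q r ν =
      ∫⁻ t in Ioi 0, ENNReal.ofReal (ν.real (Iio t) ^ q * t ^ (-(q - r))) := by
  refine setLIntegral_congr_fun measurableSet_Ioi fun t _ => ?_
  rw [ENNReal.ofReal_mul (Real.rpow_nonneg measureReal_nonneg _),
    ← ENNReal.ofReal_rpow_of_nonneg measureReal_nonneg hq, ofReal_measureReal]

lemma blissEnergy_ne_top (hr : 0 ≤ r) (hq : r + 1 < q) (hν : ν ≤ M • volume)
    (hν0 : ν (Iio 0) = 0) : blissEnergy q r ν ≠ ∞ := by
  rw [blissEnergy_eq_lintegral_ofReal (by linarith) r ν]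
  exact (integrableOn_measureReal_Iio_rpow_mul_rpow hr hq hν hν0).lintegral_lt_top.ne

lemma setIntegral_Ioi_measureReal_Iio_rpow_mul_rpow (hq : 0 < q) (r : ℝ) (hs : 0 ≤ s)
    (hνs : ν.real (Iio s) = 0) :
    ∫ t in Ioi s, ν.real (Iio t) ^ q * t ^ (-(q - r)) = (blissEnergy q r ν).toReal := by
  have hm : Measurable fun t => ν.real (Iio t) :=
    Monotone.measurable fun _ _ h => measureReal_mono (Iio_subset_Iio h)
  have hzero : ∀ t ∈ Ioi (0 : ℝ) \ Ioi s, ν.real (Iio t) ^ q * t ^ (-(q - r)) = 0 := by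
    intro t ht
    have : ν.real (Iio t) = 0 := le_antisymm
      ((measureReal_mono (Iio_subset_Iio (not_lt.1 ht.2))).trans_eq hνs) measureReal_nonneg
    rw [this, Real.zero_rpow hq.ne', zero_mul]
  rw [← setIntegral_eq_of_subset_of_forall_sdiff_eq_zero measurableSet_Ioi
    (Ioi_subset_Ioi hs) hzero, blissEnergy_eq_lintegral_ofReal hq.le]
  refine integral_eq_lintegral_of_nonneg_ae ?_ (by fun_prop)
  filter_upwards [ae_restrict_mem measurableSet_Ioi] with t ht
  exact mul_nonneg (Real.rpow_nonneg measureReal_nonneg _) (Real.rpow_nonneg (le_of_lt ht) _)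

lemma exists_isBlissTransport_measureReal_Iio (hr : 0 < r) (hq : r + 1 < q)
    (hν : ν ≤ M • volume) (hν0 : ν (Iio 0) = 0)
    (hE : blissEnergy q r ν = ENNReal.ofReal (blissMass q r / (q - r - 1))) :
    ∃ s T, 0 ≤ s ∧ ν.real (Iio s) = 0 ∧ (∀ x ∈ Ioi s, 0 < ν.real (Iio x)) ∧
      IsBlissTransport q r s (fun x => ν.real (Iio x)) T := by
  have hmass : 0 < blissMass q r / (q - r - 1) :=
    div_pos (blissMass_pos hr (by linarith)) (by linarith)
  obtain ⟨t, ht⟩ : ∃ t, 0 < ν.real (Iio t) := by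
    by_contra! h
    have hzero : ∀ t, ν (Iio t) = 0 := fun t =>
      (measureReal_eq_zero_iff).1 (le_antisymm (h t) measureReal_nonneg)
    have : blissEnergy q r ν = 0 := by
      simp [blissEnergy, hzero, ENNReal.zero_rpow_of_pos (show 0 < q by linarith)]
    rw [this] at hE
    exact (ENNReal.ofReal_pos.2 hmass).ne hE
  have hF := continuous_measureReal_Iio hν
  obtain ⟨s, hs, hνs, hpos⟩ := exists_eq_zero_forall_Ioi_pos hF
    (fun _ _ h => measureReal_mono (Iio_subset_Iio h)) (by simp [measureReal_def, hν0]) ht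
  obtain ⟨T, hT⟩ := exists_isBlissTransport hr hq hs hF.continuousOn hpos
    ((integrableOn_measureReal_Iio_rpow_mul_rpow hr.le hq hν hν0).mono_set (Ioi_subset_Ioi hs))
    (by rw [setIntegral_Ioi_measureReal_Iio_rpow_mul_rpow (by linarith) r hs hνs, hE,
      ENNReal.toReal_ofReal hmass.le])
  exact ⟨s, T, hs, hνs, hpos, hT⟩

theorem exists_ofReal_blissMass_le_lintegral (hr : 0 < r) (hq : r + 1 < q)
    (hν : ν ≤ M • volume) (hν0 : ν (Iio 0) = 0)
    (hE : blissEnergy q r ν = ENNReal.ofReal (blissMass q r / (q - r - 1))) :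
    ∃ ψ : ℝ → ℝ≥0∞, Measurable ψ ∧ ENNReal.ofReal (blissMass q r) ≤ ∫⁻ t, ψ t ∂ν ∧
      ∫⁻ t in Ioi 0, ψ t ^ (q / (q - r - 1)) = ENNReal.ofReal (blissMass q r) := by
  have := nullSingletonClass_of_le_smul_volume hν
  have hq1 : 0 < q - r - 1 := by linarith
  have hp : 0 < q / (q - r - 1) := div_pos (by linarith) hq1
  obtain ⟨s, T, hs, hνs, hpos, hT⟩ := exists_isBlissTransport_measureReal_Iio hr hq hν hν0 hE
  let w : ℝ → ℝ := fun t => ν.real (Iio t) ^ (q - r - 1) * blissWeight q r T t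
  have hw0 : ∀ t ∈ Ioi s, 0 ≤ w t := fun t ht =>
    mul_nonneg (Real.rpow_nonneg measureReal_nonneg _) (hT.blissWeight_pos hs ht).le
  have hw : ContinuousOn w (Ioi s) :=
    ((continuous_measureReal_Iio hν).continuousOn.rpow_const fun _ _ => Or.inr hq1.le).mul
      fun t ht => (hT.hasDerivAt_blissWeight hs ht).continuousAt.continuousWithinAt
  refine ⟨(Ioi s).indicator fun t => ENNReal.ofReal (w t), ?_, ?_, ?_⟩
  · rw [← piecewise_eq_indicator]
    exact (ENNReal.continuous_ofReal.comp_continuousOn hw).measurable_piecewise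
      continuousOn_const measurableSet_Ioi
  · rw [lintegral_indicator measurableSet_Ioi]
    exact hT.ofReal_blissMass_le_lintegral ν hr hq hs hνs hpos
  · calc ∫⁻ t in Ioi 0, (Ioi s).indicator (fun t => ENNReal.ofReal (w t)) t ^ (q / (q - r - 1))
        = ∫⁻ t in Ioi 0, (Ioi s).indicator
            (fun t => ENNReal.ofReal (w t ^ (q / (q - r - 1)))) t := by
          refine lintegral_congr fun t => ?_
          by_cases ht : t ∈ Ioi s
          · rw [indicator_of_mem ht, indicator_of_mem ht,
              ENNReal.ofReal_rpow_of_nonneg (hw0 t ht) hp.le]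
          · rw [indicator_of_notMem ht, indicator_of_notMem ht, ENNReal.zero_rpow_of_pos hp]
      _ = ∫⁻ t in Ioi s, ENNReal.ofReal (w t ^ (q / (q - r - 1))) := by
          rw [lintegral_indicator measurableSet_Ioi, Measure.restrict_restrict measurableSet_Ioi,
            inter_eq_left.2 (Ioi_subset_Ioi hs)]
      _ = _ := hT.lintegral_blissWeight_rpow hr hq hs hpos

end BlissEnergy

section BlissInequality

variable {E : Type*} [MeasurableSpace E] {μ : Measure E} {V : E → ℝ} {f : E → ℝ≥0∞} {q r : ℝ}

lemma map_withDensity_apply (hV : Measurable V) (f : E → ℝ≥0∞) {A : Set ℝ}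
    (hA : MeasurableSet A) : (μ.withDensity f).map V A = ∫⁻ y in V ⁻¹' A, f y ∂μ := by
  rw [Measure.map_apply hV hA, withDensity_apply _ (hV hA)]

lemma map_withDensity_le (hV : MeasurePreserving V μ (volume.restrict (Ioi 0))) {M : NNReal}
    (hM : ∀ y, f y ≤ M) : (μ.withDensity f).map V ≤ M • volume := by
  refine Measure.le_iff.2 fun A hA => ?_
  calc (μ.withDensity f).map V A = ∫⁻ y in V ⁻¹' A, f y ∂μ :=
        map_withDensity_apply hV.measurable f hA
    _ ≤ ∫⁻ _ in V ⁻¹' A, M ∂μ := lintegral_mono hM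
    _ = M * volume.restrict (Ioi 0) A := by
        rw [setLIntegral_const, hV.measure_preimage hA.nullMeasurableSet]
    _ ≤ (M • volume) A := mul_le_mul_right (Measure.restrict_apply_le _ _) _

lemma map_withDensity_Iio_zero (hV : MeasurePreserving V μ (volume.restrict (Ioi 0)))
    (f : E → ℝ≥0∞) : (μ.withDensity f).map V (Iio 0) = 0 := by
  have h0 : μ (V ⁻¹' Iio 0) = 0 := by
    rw [hV.measure_preimage measurableSet_Iio.nullMeasurableSet,
      Measure.restrict_apply measurableSet_Iio, Iio_inter_Ioi]
    simp
  rw [map_withDensity_apply hV.measurable f measurableSet_Iio, setLIntegral_measure_zero _ _ h0]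

lemma holderConjugate_div (hr : 0 < r) (hq : r + 1 < q) :
    (q / (r + 1)).HolderConjugate (q / (q - r - 1)) := by
  refine Real.holderConjugate_iff.2 ⟨(one_lt_div (by linarith)).2 hq, ?_⟩
  have : q ≠ 0 := by linarith
  field_simp
  ring

theorem ofReal_blissMass_le_lintegral_rpow (hV : MeasurePreserving V μ (volume.restrict (Ioi 0)))
    (hr : 0 < r) (hq : r + 1 < q) (hf : Measurable f) {M : NNReal} (hM : ∀ y, f y ≤ M)
    (hfi : ∫⁻ y, f y ∂μ ≠ ∞)
    (hE : blissEnergy q r ((μ.withDensity f).map V) =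
      ENNReal.ofReal (blissMass q r / (q - r - 1))) :
    ENNReal.ofReal (blissMass q r) ≤ ∫⁻ y, f y ^ (q / (r + 1)) ∂μ := by
  have hconj := holderConjugate_div hr hq
  have := isFiniteMeasure_withDensity hfi
  obtain ⟨ψ, hψ, hle, hnorm⟩ := exists_ofReal_blissMass_le_lintegral hr hq
    (map_withDensity_le hV hM) (map_withDensity_Iio_zero hV f) hE
  have hψV : ∫⁻ y, ψ (V y) ^ (q / (q - r - 1)) ∂μ = ENNReal.ofReal (blissMass q r) :=
    (hV.lintegral_comp (hψ.pow_const _)).trans hnorm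
  have hholder : ENNReal.ofReal (blissMass q r) ≤
      (∫⁻ y, f y ^ (q / (r + 1)) ∂μ) ^ (1 / (q / (r + 1))) *
        ENNReal.ofReal (blissMass q r) ^ (1 / (q / (q - r - 1))) := by
    rw [← hψV]
    calc ∫⁻ y, ψ (V y) ^ (q / (q - r - 1)) ∂μ
        ≤ ∫⁻ t, ψ t ∂(μ.withDensity f).map V := hψV.trans_le hle
      _ = ∫⁻ y, f y * ψ (V y) ∂μ := by
          rw [lintegral_map hψ hV.measurable]
          exact lintegral_withDensity_eq_lintegral_mul _ hf (hψ.comp hV.measurable)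
      _ ≤ _ := ENNReal.lintegral_mul_le_Lp_mul_Lq μ hconj hf.aemeasurable
          (hψ.comp hV.measurable).aemeasurable
  refine (le_rpow_of_le_mul_rpow hconj ENNReal.ofReal_ne_top hholder).trans_eq ?_
  rw [← ENNReal.rpow_mul, one_div_mul_cancel hconj.ne_zero, ENNReal.rpow_one]

lemma exists_coe_rpow_mul_eq {A c : ℝ≥0∞} (hq : 0 < q) (hA : A ≠ 0) (hA' : A ≠ ∞)
    (hc : c ≠ ∞) : ∃ l : NNReal, (l : ℝ≥0∞) ^ q * A = c := by
  have htop : (c / A) ^ (1 / q) ≠ ∞ :=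
    ENNReal.rpow_ne_top_of_nonneg (by positivity) (ENNReal.div_ne_top hc hA)
  refine ⟨((c / A) ^ (1 / q)).toNNReal, ?_⟩
  rw [ENNReal.coe_toNNReal htop, ← ENNReal.rpow_mul, one_div_mul_cancel hq.ne',
    ENNReal.rpow_one, ENNReal.div_mul_cancel hA hA']

lemma blissEnergy_map_withDensity_le_of_bounded
    (hV : MeasurePreserving V μ (volume.restrict (Ioi 0))) (hr : 0 < r) (hq : r + 1 < q)
    (hf : Measurable f) {M : NNReal} (hM : ∀ y, f y ≤ M) (hfi : ∫⁻ y, f y ∂μ ≠ ∞) :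
    blissEnergy q r ((μ.withDensity f).map V) ≤
      ENNReal.ofReal (blissMass q r ^ (-r) / (q - r - 1)) *
        (∫⁻ y, f y ^ (q / (r + 1)) ∂μ) ^ (r + 1) := by
  have hq0 : 0 < q := by linarith
  have hr1 : 0 < r + 1 := by linarith
  have hI := blissMass_pos hr (show 1 < q by linarith)
  have := isFiniteMeasure_withDensity hfi
  have hAtop : blissEnergy q r ((μ.withDensity f).map V) ≠ ∞ :=
    blissEnergy_ne_top hr.le hq (map_withDensity_le hV hM) (map_withDensity_Iio_zero hV f)
  set A := blissEnergy q r ((μ.withDensity f).map V) with hA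
  set I := blissMass q r
  rcases eq_or_ne A 0 with h0 | h0
  · rw [h0]; exact zero_le
  -- Both sides are homogeneous of degree `q` in `f`, so `f` can be normalised.
  obtain ⟨l, hl⟩ := exists_coe_rpow_mul_eq hq0 h0 hAtop
    (ENNReal.ofReal_ne_top (r := I / (q - r - 1)))
  have hscaled : ENNReal.ofReal I ≤ (l : ℝ≥0∞) ^ (q / (r + 1)) * ∫⁻ y, f y ^ (q / (r + 1)) ∂μ := by
    have := ofReal_blissMass_le_lintegral_rpow (f := (l : ℝ≥0∞) • f) (M := l * M) hV hr hq
      (hf.const_smul _) (fun y => by simpa using mul_le_mul_right (hM y) _)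
      (by simpa [lintegral_const_mul _ hf] using ENNReal.mul_ne_top ENNReal.coe_ne_top hfi)
      (by rw [withDensity_smul _ hf, Measure.map_smul, blissEnergy_smul hq0.le _ _
        ENNReal.coe_ne_top, ← hA, hl])
    simpa [ENNReal.mul_rpow_of_nonneg, div_nonneg hq0.le hr1.le,
      lintegral_const_mul _ (hf.pow_const (q / (r + 1)))] using this
  calc A = A * ENNReal.ofReal I ^ (r + 1) * ENNReal.ofReal (I ^ (-(r + 1))) := by
        rw [mul_assoc, ENNReal.ofReal_rpow_of_pos hI, ← ENNReal.ofReal_mul (by positivity),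
          ← Real.rpow_add hI, add_neg_cancel, Real.rpow_zero, ENNReal.ofReal_one, mul_one]
    _ ≤ A * ((l : ℝ≥0∞) ^ (q / (r + 1)) * ∫⁻ y, f y ^ (q / (r + 1)) ∂μ) ^ (r + 1) *
          ENNReal.ofReal (I ^ (-(r + 1))) := by gcongr
    _ = (l ^ q * A) * ENNReal.ofReal (I ^ (-(r + 1))) *
          (∫⁻ y, f y ^ (q / (r + 1)) ∂μ) ^ (r + 1) := by
        rw [ENNReal.mul_rpow_of_nonneg _ _ hr1.le, ← ENNReal.rpow_mul,
          div_mul_cancel₀ _ hr1.ne']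
        ring
    _ = _ := by
        rw [hl, ← ENNReal.ofReal_mul (div_nonneg hI.le (by linarith)), div_mul_eq_mul_div,
          ← Real.rpow_one_add' hI.le (by linarith)]
        ring_nf

lemma exists_monotone_truncation (hV : MeasurePreserving V μ (volume.restrict (Ioi 0)))
    (hf : Measurable f) :
    ∃ g : ℕ → E → ℝ≥0∞, (∀ k, Measurable (g k)) ∧ Monotone g ∧ (∀ k, g k ≤ f) ∧
      (∀ y, Tendsto (fun k => g k y) atTop (𝓝 (f y))) ∧ (∀ k y, g k y ≤ (k : NNReal)) ∧
      ∀ k, ∫⁻ y, g k y ∂μ ≠ ∞ := by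
  have hVk (k : ℕ) : MeasurableSet {y | V y < k} := hV.measurable measurableSet_Iio
  refine ⟨fun k => {y | V y < k}.indicator fun y => min (f y) k,
    fun k => (hf.min measurable_const).indicator (hVk k), fun k l hkl y => ?_,
    fun k => (indicator_le_self _ _).trans fun y => min_le_left _ _, fun y => ?_,
    fun k y => (indicator_le_self _ _ y).trans (min_le_right _ _), fun k => ?_⟩
  · refine (indicator_le_indicator (by gcongr)).trans
      (indicator_le_indicator_of_subset (fun x (hx : V x < k) => ?_) (fun _ => zero_le) y)
    exact hx.trans_le (Nat.cast_le.2 hkl)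
  · have hmin : Tendsto (fun k : ℕ => min (f y) (k : ℝ≥0∞)) atTop (𝓝 (f y)) := by
      simpa using tendsto_const_nhds.min ENNReal.tendsto_nat_nhds_top
    refine hmin.congr' ?_
    filter_upwards [tendsto_natCast_atTop_atTop.eventually_gt_atTop (V y)] with k hk
    rw [indicator_of_mem (show y ∈ {y | V y < k} from hk)]
  · have hμk : μ {y | V y < k} ≠ ∞ := by
      have := hV.measure_preimage (measurableSet_Iio (a := (k : ℝ))).nullMeasurableSet
      rw [Measure.restrict_apply measurableSet_Iio, inter_comm, Ioi_inter_Iio,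
        Real.volume_Ioo] at this
      exact this.trans_ne ENNReal.ofReal_ne_top
    rw [lintegral_indicator (hVk k)]
    exact ((setLIntegral_mono measurable_const fun y _ => min_le_right _ _).trans_lt
      (by rw [setLIntegral_const]; finiteness)).ne

/-- **Bliss' inequality**. -/
theorem blissEnergy_map_withDensity_le (hV : MeasurePreserving V μ (volume.restrict (Ioi 0)))
    (hr : 0 < r) (hq : r + 1 < q) (hf : Measurable f) :
    blissEnergy q r ((μ.withDensity f).map V) ≤
      ENNReal.ofReal (blissMass q r ^ (-r) / (q - r - 1)) *
        (∫⁻ y, f y ^ (q / (r + 1)) ∂μ) ^ (r + 1) := by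
  have hq0 : 0 ≤ q := by linarith
  obtain ⟨g, hg, hmono, hle, hlim, hbdd, hint⟩ := exists_monotone_truncation hV hf
  have htendsto : Tendsto (fun k => blissEnergy q r ((μ.withDensity (g k)).map V)) atTop
      (𝓝 (blissEnergy q r ((μ.withDensity f).map V))) := by
    refine tendsto_blissEnergy hq0 r
      (fun k l hkl => Measure.map_mono (withDensity_mono (ae_of_all _ (hmono hkl))) hV.measurable)
      fun t => ?_
    simp only [map_withDensity_apply hV.measurable _ measurableSet_Iio]
    exact lintegral_tendsto_of_tendsto_of_monotone (fun k => (hg k).aemeasurable)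
      (ae_of_all _ fun y k l hkl => hmono hkl y) (ae_of_all _ hlim)
  refine le_of_tendsto' htendsto fun k => ?_
  refine (blissEnergy_map_withDensity_le_of_bounded hV hr hq (hg k) (hbdd k) (hint k)).trans ?_
  gcongr with y
  exact hle k y

end BlissInequality

section BlissExtremal

variable {E : Type*} [MeasurableSpace E] {μ : Measure E} {V : E → ℝ} {q r t : ℝ}

/-- The extremal function of Bliss' inequality. -/
noncomputable def blissExtremal (r t : ℝ) : ℝ := (1 + t ^ r) ^ (-((r + 1) / r))

lemma measurable_blissExtremal (r : ℝ) : Measurable (blissExtremal r) := by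
  unfold blissExtremal
  fun_prop

lemma blissExtremal_nonneg (ht : 0 ≤ t) (r : ℝ) : 0 ≤ blissExtremal r t :=
  (Real.rpow_pos_of_pos (one_add_rpow_pos ht r) _).le

lemma hasDerivAt_mul_one_add_rpow_neg_one_div (hr : r ≠ 0) (ht : 0 < t) :
    HasDerivAt (fun t : ℝ => t * (1 + t ^ r) ^ (-(1 / r))) (blissExtremal r t) t := by
  have hP := one_add_rpow_pos ht.le r
  have hbase : HasDerivAt (fun y : ℝ => 1 + y ^ r) (r * t ^ (r - 1)) t :=
    (Real.hasDerivAt_rpow_const (Or.inl ht.ne')).const_add 1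
  refine ((hasDerivAt_id t).mul
    (hbase.rpow_const (p := -(1 / r)) (Or.inl hP.ne'))).congr_deriv ?_
  have hexp : -((r + 1) / r) = -(1 / r) - 1 := by field_simp; ring
  have hfactor : (1 + t ^ r) ^ (-(1 / r)) = (1 + t ^ r) ^ (-(1 / r) - 1) * (1 + t ^ r) := by
    rw [← Real.rpow_add_one hP.ne', sub_add_cancel]
  rw [blissExtremal, hexp, hfactor, Real.rpow_sub_one ht.ne', id]
  field_simp
  ring

lemma setLIntegral_Ioo_blissExtremal (hr : 0 < r) (ht : 0 ≤ t) :
    ∫⁻ s in Ioo 0 t, ENNReal.ofReal (blissExtremal r s) =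
      ENNReal.ofReal (t * (1 + t ^ r) ^ (-(1 / r))) := by
  have hcont (e : ℝ) : ContinuousOn (fun s : ℝ => (1 + s ^ r) ^ e) (Icc 0 t) :=
    (continuousOn_one_add_rpow_rpow hr.le e).mono Icc_subset_Ici_self
  have hint : IntegrableOn (blissExtremal r) (Icc 0 t) := (hcont _).integrableOn_Icc
  have hFTC := intervalIntegral.integral_eq_sub_of_hasDerivAt_of_le ht
    (continuousOn_id.mul (hcont _))
    (fun s hs => hasDerivAt_mul_one_add_rpow_neg_one_div hr.ne' hs.1)
    ((hcont _).intervalIntegrable_of_Icc ht)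
  simp only [id, Pi.mul_apply, zero_mul, sub_zero] at hFTC
  rw [← hFTC, intervalIntegral.integral_of_le ht, integral_Ioc_eq_integral_Ioo,
    ofReal_integral_eq_lintegral_ofReal (hint.mono_set Ioo_subset_Icc_self)]
  filter_upwards [ae_restrict_mem measurableSet_Ioo] with s hs
  exact blissExtremal_nonneg hs.1.le r

lemma lintegral_blissExtremal_rpow (hV : MeasurePreserving V μ (volume.restrict (Ioi 0)))
    (hr : 0 < r) (hq : 1 < q) :
    ∫⁻ y, ENNReal.ofReal (blissExtremal r (V y)) ^ (q / (r + 1)) ∂μ =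
      ENNReal.ofReal (blissMass q r) := by
  rw [hV.lintegral_comp (f := fun t => ENNReal.ofReal (blissExtremal r t) ^ (q / (r + 1)))
      ((measurable_blissExtremal r).ennreal_ofReal.pow_const _),
    blissMass, ofReal_integral_eq_lintegral_ofReal (integrableOn_blissMass hr hq)]
  · refine setLIntegral_congr_fun measurableSet_Ioi fun t ht => ?_
    have hP := one_add_rpow_pos (le_of_lt ht) r
    have : 0 < q := one_pos.trans hq
    rw [ENNReal.ofReal_rpow_of_nonneg (blissExtremal_nonneg (le_of_lt ht) r) (by positivity),
      blissExtremal, ← Real.rpow_mul hP.le]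
    congr 2
    field_simp
  · filter_upwards [ae_restrict_mem measurableSet_Ioi] with y hy
    exact (Real.rpow_pos_of_pos (one_add_rpow_pos (le_of_lt hy) r) _).le

theorem blissEnergy_map_withDensity_blissExtremal
    (hV : MeasurePreserving V μ (volume.restrict (Ioi 0))) (hr : 0 < r) (hq : r + 1 < q) :
    blissEnergy q r ((μ.withDensity fun y => ENNReal.ofReal (blissExtremal r (V y))).map V) =
      ENNReal.ofReal (blissMass q r / (q - r - 1)) := by
  have hq0 : 0 < q := by linarith
  rw [blissEnergy, ← integral_rpow_mul_one_add_rpow hr hq, ofReal_integral_eq_lintegral_ofReal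
    (integrableOn_rpow_mul_one_add_rpow hr hq)]
  · refine setLIntegral_congr_fun measurableSet_Ioi fun t ht => ?_
    have ht0 : (0 : ℝ) < t := ht
    have hP := one_add_rpow_pos ht0.le r
    have hdistr : ∫⁻ y in V ⁻¹' Iio t, ENNReal.ofReal (blissExtremal r (V y)) ∂μ =
        ∫⁻ s in Ioo 0 t, ENNReal.ofReal (blissExtremal r s) := by
      rw [hV.setLIntegral_comp_preimage (f := fun t => ENNReal.ofReal (blissExtremal r t))
          measurableSet_Iio (measurable_blissExtremal r).ennreal_ofReal,
        Measure.restrict_restrict measurableSet_Iio, inter_comm, Ioi_inter_Iio]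
    rw [map_withDensity_apply hV.measurable _ measurableSet_Iio, hdistr,
      setLIntegral_Ioo_blissExtremal hr ht0.le,
      ENNReal.ofReal_rpow_of_nonneg (by positivity) hq0.le, ← ENNReal.ofReal_mul (by positivity),
      Real.mul_rpow ht0.le (by positivity), ← Real.rpow_mul hP.le, mul_right_comm,
      ← Real.rpow_add ht0]
    ring_nf
  · filter_upwards [ae_restrict_mem measurableSet_Ioi] with y hy
    exact mul_nonneg (Real.rpow_nonneg (le_of_lt hy) _)
      (Real.rpow_nonneg (one_add_rpow_pos (le_of_lt hy) r).le _)

end BlissExtremal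

section HardyKernel

variable {n : ℕ}

/-- The Lebesgue measure of the ball `B(0,|x|)`, used as a measure-preserving radial coordinate
on `ℝⁿ`. -/
noncomputable def ballVol (x : EuclideanSpace ℝ (Fin n)) : ℝ :=
  volume.real (Metric.ball (0 : EuclideanSpace ℝ (Fin n)) ‖x‖)

lemma ballVol_nonneg (x : EuclideanSpace ℝ (Fin n)) : 0 ≤ ballVol x := measureReal_nonneg

lemma ballVol_eq_norm_pow_mul (hn : 0 < n) (x : EuclideanSpace ℝ (Fin n)) :
    ballVol x = ‖x‖ ^ n * volume.real (Metric.ball (0 : EuclideanSpace ℝ (Fin n)) 1) := by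
  have : Nonempty (Fin n) := ⟨⟨0, hn⟩⟩
  rw [ballVol, measureReal_def, Measure.addHaar_ball _ _ (norm_nonneg x), ENNReal.toReal_mul,
    ENNReal.toReal_ofReal (by positivity), finrank_euclideanSpace_fin, measureReal_def]

lemma volume_real_unitBall_pos :
    0 < volume.real (Metric.ball (0 : EuclideanSpace ℝ (Fin n)) 1) :=
  ENNReal.toReal_pos (Metric.measure_ball_pos _ _ one_pos).ne' measure_ball_lt_top.ne

lemma measurable_ballVol (hn : 0 < n) :
    Measurable (ballVol : EuclideanSpace ℝ (Fin n) → ℝ) := by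
  simp_rw [funext (ballVol_eq_norm_pow_mul hn)]
  fun_prop

lemma ballVol_preimage_Iio (hn : 0 < n) (x : EuclideanSpace ℝ (Fin n)) :
    ballVol ⁻¹' Iio (ballVol x) = Metric.ball (0 : EuclideanSpace ℝ (Fin n)) ‖x‖ := by
  ext y
  rw [mem_ball_zero_iff, mem_preimage, mem_Iio, ballVol_eq_norm_pow_mul hn,
    ballVol_eq_norm_pow_mul hn, mul_lt_mul_iff_left₀ volume_real_unitBall_pos,
    pow_lt_pow_iff_left₀ (norm_nonneg _) (norm_nonneg _) hn.ne']

lemma exists_ballVol_eq (hn : 0 < n) {t : ℝ} (ht : 0 ≤ t) :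
    ∃ x : EuclideanSpace ℝ (Fin n), ballVol x = t := by
  have hc := volume_real_unitBall_pos (n := n)
  set c := volume.real (Metric.ball (0 : EuclideanSpace ℝ (Fin n)) 1)
  have : Nonempty (Fin n) := ⟨⟨0, hn⟩⟩
  obtain ⟨x, hx⟩ := exists_norm_eq (EuclideanSpace ℝ (Fin n))
    (c := (t / c) ^ (1 / (n : ℝ))) (by positivity)
  refine ⟨x, ?_⟩
  rw [ballVol_eq_norm_pow_mul hn, hx, ← Real.rpow_natCast, ← Real.rpow_mul (by positivity),
    one_div_mul_cancel (by positivity), Real.rpow_one]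
  exact div_mul_cancel₀ _ hc.ne'

lemma volume_ballVol_preimage_Iio (hn : 0 < n) (t : ℝ) :
    volume (ballVol ⁻¹' Iio t : Set (EuclideanSpace ℝ (Fin n))) = ENNReal.ofReal t := by
  rcases le_total t 0 with ht | ht
  · rw [ENNReal.ofReal_of_nonpos ht, preimage_eq_empty, measure_empty]
    exact disjoint_left.2 fun s hs ⟨x, hx⟩ => (hs.trans_le ht).not_ge (hx ▸ ballVol_nonneg x)
  · obtain ⟨x, rfl⟩ := exists_ballVol_eq hn ht
    rw [ballVol_preimage_Iio hn, ballVol, ofReal_measureReal]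

theorem measurePreserving_ballVol (hn : 0 < n) :
    MeasurePreserving (ballVol : EuclideanSpace ℝ (Fin n) → ℝ) volume
      (volume.restrict (Ioi 0)) := by
  have hIio (t : ℝ) : (volume : Measure (EuclideanSpace ℝ (Fin n))).map ballVol (Iio t) =
      ENNReal.ofReal t := by
    rw [Measure.map_apply (measurable_ballVol hn) measurableSet_Iio,
      volume_ballVol_preimage_Iio hn]
  refine ⟨measurable_ballVol hn, Measure.ext_of_generateFrom_of_iUnion (range Iio)
    (fun k : ℕ => Iio (k : ℝ)) (borel_eq_generateFrom_Iio ℝ ▸ BorelSpace.measurable_eq)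
    isPiSystem_Iio (iUnion_eq_univ_iff.2 exists_nat_gt) (fun k => mem_range_self _)
    (fun k => by simp only [hIio, ne_eq, ENNReal.ofReal_ne_top, not_false_eq_true]) ?_⟩
  rintro _ ⟨t, rfl⟩
  rw [hIio, Measure.restrict_apply measurableSet_Iio, inter_comm, Ioi_inter_Iio,
    Real.volume_Ioo, sub_zero]

/-- The integral kernel of the fractional Hardy operator of order `a n` on `ℝⁿ`. -/
noncomputable def hardyKernel (a : ℝ) (x y : EuclideanSpace ℝ (Fin n)) : ℝ≥0∞ :=
  (Metric.ball 0 ‖x‖).indicator (fun _ => ENNReal.ofReal (1 / ballVol x ^ (1 - a))) y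

lemma measurable_hardyKernel (hn : 0 < n) (a : ℝ) :
    Measurable (uncurry (hardyKernel (n := n) a)) := by
  have hweight : Measurable fun z : EuclideanSpace ℝ (Fin n) × EuclideanSpace ℝ (Fin n) =>
      ENNReal.ofReal (1 / ballVol z.1 ^ (1 - a)) :=
    ((((measurable_ballVol hn).comp measurable_fst).pow_const _).const_div 1).ennreal_ofReal
  have hset : MeasurableSet {z : EuclideanSpace ℝ (Fin n) × EuclideanSpace ℝ (Fin n) |
      ‖z.2‖ < ‖z.1‖} := measurableSet_lt (by fun_prop) (by fun_prop)
  convert hweight.indicator hset using 1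
  ext z
  by_cases hz : ‖z.2‖ < ‖z.1‖ <;> simp [uncurry, hardyKernel, hz]

lemma lintegral_hardyKernel_mul (a : ℝ) (x : EuclideanSpace ℝ (Fin n))
    (g : EuclideanSpace ℝ (Fin n) → ℝ≥0∞) :
    ∫⁻ y, hardyKernel a x y * g y =
      ENNReal.ofReal (1 / ballVol x ^ (1 - a)) * ∫⁻ y in Metric.ball 0 ‖x‖, g y := by
  rw [← lintegral_const_mul' _ _ ENNReal.ofReal_ne_top,
    ← lintegral_indicator Metric.isOpen_ball.measurableSet]
  simp only [hardyKernel, indicator_mul_left]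

variable {q r : ℝ}

theorem lintegral_lintegral_hardyKernel_mul_rpow (hn : 0 < n) (hq : 0 < q) (a : ℝ)
    (g : EuclideanSpace ℝ (Fin n) → ℝ≥0∞) :
    ∫⁻ x, (∫⁻ y, hardyKernel a x y * g y) ^ q =
      blissEnergy q (q * a) ((volume.withDensity g).map ballVol) := by
  rw [blissEnergy, ← (measurePreserving_ballVol hn).lintegral_comp
    (measurable_blissEnergy_integrand q (q * a) _)]
  refine lintegral_congr fun x => ?_
  have hx := ballVol_nonneg x
  rw [lintegral_hardyKernel_mul, map_withDensity_apply (measurable_ballVol hn) g measurableSet_Iio,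
    ballVol_preimage_Iio hn, ENNReal.mul_rpow_of_nonneg _ _ hq.le,
    ENNReal.ofReal_rpow_of_nonneg (by positivity) hq.le, mul_comm, one_div, ← Real.rpow_neg hx,
    ← Real.rpow_mul hx]
  ring_nf

theorem hasKernelBound_hardyKernel (hn : 0 < n) (hr : 0 < r) (hq : r + 1 < q) :
    HasKernelBound volume volume (q / (r + 1)) q (hardyKernel (n := n) (r / q))
      (ENNReal.ofReal (blissMass q r ^ (-r) / (q - r - 1))) := by
  intro g hg
  have hq0 : 0 < q := by linarith
  rw [lintegral_lintegral_hardyKernel_mul_rpow hn hq0, mul_div_cancel₀ _ hq0.ne',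
    div_div_cancel₀ hq0.ne']
  exact blissEnergy_map_withDensity_le (measurePreserving_ballVol hn) hr hq hg

lemma measurable_ofReal_blissExtremal_ballVol (hn : 0 < n) (r : ℝ) :
    Measurable fun y : EuclideanSpace ℝ (Fin n) =>
      ENNReal.ofReal (blissExtremal r (ballVol y)) :=
  ((measurable_blissExtremal r).comp (measurable_ballVol hn)).ennreal_ofReal

lemma lintegral_lintegral_hardyKernel_mul_blissExtremal_rpow (hn : 0 < n) (hr : 0 < r)
    (hq : r + 1 < q) :
    ∫⁻ x : EuclideanSpace ℝ (Fin n),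
        (∫⁻ y, hardyKernel (r / q) x y * ENNReal.ofReal (blissExtremal r (ballVol y))) ^ q =
      ENNReal.ofReal (blissMass q r / (q - r - 1)) := by
  have hq0 : 0 < q := by linarith
  rw [lintegral_lintegral_hardyKernel_mul_rpow hn hq0, mul_div_cancel₀ _ hq0.ne',
    blissEnergy_map_withDensity_blissExtremal (measurePreserving_ballVol hn) hr hq]

end HardyKernel

section LebesgueNorm

variable {X Y E F : Type*} [MeasurableSpace X] [MeasurableSpace Y] [NormedAddCommGroup E]
  [NormedAddCommGroup F] {μ : Measure X} {ν : Measure Y}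

lemma eLpNorm_ofReal_exponent {s : ℝ} (hs : 0 < s) (f : X → E) (μ : Measure X) :
    eLpNorm f (ENNReal.ofReal s) μ = (∫⁻ x, ‖f x‖ₑ ^ s ∂μ) ^ (1 / s) := by
  rw [eLpNorm_eq_lintegral_rpow_enorm_toReal (ENNReal.ofReal_pos.2 hs).ne' ENNReal.ofReal_ne_top,
    ENNReal.toReal_ofReal hs.le]

theorem HasKernelBound.eLpNorm_le {p q : ℝ} {K : X → Y → ℝ≥0∞} {D : ℝ≥0∞}
    (hK : HasKernelBound μ ν p q K D) (hp : 0 < p) (hq : 0 < q) {f : Y → E}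
    (hf : AEStronglyMeasurable f ν) {u : X → F} (hu : ∀ x, ‖u x‖ₑ ≤ ∫⁻ y, K x y * ‖f y‖ₑ ∂ν) :
    eLpNorm u (ENNReal.ofReal q) μ ≤
      D ^ (1 / q) * eLpNorm f (ENNReal.ofReal p) ν := by
  rw [eLpNorm_congr_ae hf.ae_eq_mk, eLpNorm_ofReal_exponent hp,
    eLpNorm_ofReal_exponent hq]
  calc (∫⁻ x, ‖u x‖ₑ ^ q ∂μ) ^ (1 / q)
      ≤ (∫⁻ x, (∫⁻ y, K x y * ‖hf.mk f y‖ₑ ∂ν) ^ q ∂μ) ^ (1 / q) := by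
        gcongr with x
        refine (hu x).trans (lintegral_congr_ae ?_).le
        filter_upwards [hf.ae_eq_mk] with y hy
        rw [hy]
    _ ≤ (D * (∫⁻ y, ‖hf.mk f y‖ₑ ^ p ∂ν) ^ (q / p)) ^ (1 / q) := by
        gcongr
        exact hK _ hf.stronglyMeasurable_mk.enorm
    _ = _ := by
        rw [ENNReal.mul_rpow_of_nonneg _ _ (by positivity), ← ENNReal.rpow_mul,
          div_mul_div_comm, mul_one, mul_comm p, ← div_div, div_self hq.ne']

variable {𝕜 : Type*} [RCLike 𝕜] [NormedSpace 𝕜 E] [NormedSpace 𝕜 F] {p q : ℝ≥0∞}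
  [Fact (1 ≤ p)] [Fact (1 ≤ q)] {C : ℝ}

theorem exists_continuousLinearMap_of_eLpNorm_le (hC : 0 ≤ C) {A : (X → E) → Y → F}
    (hmem : ∀ f : Lp E p μ, MemLp (A f) q ν)
    (hadd : ∀ f g : Lp E p μ, A ↑(f + g) =ᵐ[ν] A f + A g)
    (hsmul : ∀ (c : 𝕜) (f : Lp E p μ), A ↑(c • f) =ᵐ[ν] c • A f)
    (hle : ∀ f : Lp E p μ, eLpNorm (A f) q ν ≤ ENNReal.ofReal C * eLpNorm f p μ) :
    ∃ T : Lp E p μ →L[𝕜] Lp F q ν, (∀ f, T f =ᵐ[ν] A f) ∧ ‖T‖ ≤ C := by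
  let L : Lp E p μ →ₗ[𝕜] Lp F q ν :=
    { toFun := fun f => (hmem f).toLp
      map_add' := fun f g => by
        rw [← MemLp.toLp_add, MemLp.toLp_eq_toLp_iff]
        exact hadd f g
      map_smul' := fun c f => by
        rw [RingHom.id_apply, ← MemLp.toLp_const_smul, MemLp.toLp_eq_toLp_iff]
        exact hsmul c f }
  have hL (f : Lp E p μ) : ‖L f‖ ≤ C * ‖f‖ := by
    change ‖(hmem f).toLp‖ ≤ _
    rw [Lp.norm_toLp, Lp.norm_def, ← ENNReal.toReal_ofReal hC, ← ENNReal.toReal_mul]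
    exact ENNReal.toReal_mono (ENNReal.mul_ne_top ENNReal.ofReal_ne_top (Lp.eLpNorm_ne_top f))
      (hle f)
  exact ⟨L.mkContinuous C hL, fun f => (hmem f).coeFn_toLp, L.mkContinuous_norm_le hC hL⟩

theorem le_norm_of_eLpNorm_eq (hC : 0 ≤ C) {T : Lp E p μ →L[𝕜] Lp F q ν} {f : Lp E p μ}
    (hf : eLpNorm f p μ ≠ 0)
    (hTf : eLpNorm (T f) q ν = ENNReal.ofReal C * eLpNorm f p μ) : C ≤ ‖T‖ := by
  have hf0 : 0 < ‖f‖ := ENNReal.toReal_pos hf (Lp.eLpNorm_ne_top f)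
  refine le_of_mul_le_mul_right ?_ hf0
  calc C * ‖f‖ = ‖T f‖ := by
        rw [Lp.norm_def (T f), hTf, ENNReal.toReal_mul, ENNReal.toReal_ofReal hC, Lp.norm_def]
    _ ≤ ‖T‖ * ‖f‖ := T.le_opNorm f

end LebesgueNorm

section HardyOp

variable {𝕜 : Type*} [RCLike 𝕜] {m : ℕ} {n : Fin m → ℕ} {β : Fin m → ℝ}

/-- The factor `∏ᵢ |B(0,|xᵢ|)|^{βᵢ/nᵢ - 1}` in front of the integral defining `hardyOp`. -/
noncomputable def hardyWeight (β : Fin m → ℝ) (x : ProdSpace n) : ℝ :=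
  ∏ i, 1 / ballVol (x i) ^ (1 - β i / (n i : ℝ))

lemma hardyWeight_nonneg (β : Fin m → ℝ) (x : ProdSpace n) : 0 ≤ hardyWeight β x :=
  Finset.prod_nonneg fun i _ => by
    have := ballVol_nonneg (x i)
    positivity

lemma hardyOp_apply (β : Fin m → ℝ) (f : ProdSpace n → 𝕜) (x : ProdSpace n) :
    hardyOp β f x = hardyWeight β x • ∫ y in polyBall x, f y := rfl

lemma measurableSet_polyBall (x : ProdSpace n) : MeasurableSet (polyBall x) :=
  MeasurableSet.univ_pi fun _ => Metric.isOpen_ball.measurableSet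

lemma volume_polyBall_lt_top (x : ProdSpace n) : volume (polyBall x) < ∞ := by
  rw [polyBall, volume_pi_pi]
  exact ENNReal.prod_lt_top fun i _ => measure_ball_lt_top

lemma integrableOn_polyBall {E : Type*} [NormedAddCommGroup E] {p : ℝ≥0∞} (hp : 1 ≤ p)
    {f : ProdSpace n → E} (hf : MemLp f p volume) (x : ProdSpace n) :
    IntegrableOn f (polyBall x) volume := by
  have : IsFiniteMeasure (volume.restrict (polyBall x)) :=
    isFiniteMeasure_restrict.2 (volume_polyBall_lt_top x).ne
  exact (hf.restrict _).integrable hp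

lemma hardyOp_congr {f g : ProdSpace n → 𝕜} (h : f =ᵐ[volume] g) :
    hardyOp β f = hardyOp β g := by
  ext x
  rw [hardyOp, hardyOp, integral_congr_ae (ae_restrict_of_ae h)]

lemma hardyOp_add {f g : ProdSpace n → 𝕜} (hf : ∀ x, IntegrableOn f (polyBall x) volume)
    (hg : ∀ x, IntegrableOn g (polyBall x) volume) :
    hardyOp β (f + g) = hardyOp β f + hardyOp β g := by
  ext x
  simp only [hardyOp, Pi.add_apply]
  rw [integral_add (hf x) (hg x), smul_add]

lemma hardyOp_const_smul (c : 𝕜) (f : ProdSpace n → 𝕜) :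
    hardyOp β (c • f) = c • hardyOp β f := by
  ext x
  simp only [hardyOp, Pi.smul_apply]
  rw [integral_smul, smul_comm]

lemma prod_hardyKernel (x y : ProdSpace n) :
    ∏ i, hardyKernel (β i / n i) (x i) (y i) =
      (polyBall x).indicator (fun _ => ENNReal.ofReal (hardyWeight β x)) y := by
  by_cases hy : y ∈ polyBall x
  · rw [indicator_of_mem hy, hardyWeight, ENNReal.ofReal_prod_of_nonneg fun i _ => by
      have := ballVol_nonneg (x i)
      positivity]
    exact Finset.prod_congr rfl fun i _ => indicator_of_mem (hy i (mem_univ i)) _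
  · obtain ⟨i, hi⟩ : ∃ i, y i ∉ Metric.ball 0 ‖x i‖ := by
      simpa only [polyBall, mem_univ_pi, not_forall] using hy
    rw [indicator_of_notMem hy]
    exact Finset.prod_eq_zero (Finset.mem_univ i) (indicator_of_notMem hi _)

lemma lintegral_prod_hardyKernel_mul (x : ProdSpace n) (g : ProdSpace n → ℝ≥0∞) :
    ∫⁻ y, (∏ i, hardyKernel (β i / n i) (x i) (y i)) * g y =
      ENNReal.ofReal (hardyWeight β x) * ∫⁻ y in polyBall x, g y := by
  rw [← lintegral_const_mul' _ _ ENNReal.ofReal_ne_top,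
    ← lintegral_indicator (measurableSet_polyBall x)]
  simp only [prod_hardyKernel, indicator_mul_left]

lemma enorm_hardyOp (f : ProdSpace n → 𝕜) (x : ProdSpace n) :
    ‖hardyOp β f x‖ₑ = ENNReal.ofReal (hardyWeight β x) * ‖∫ y in polyBall x, f y‖ₑ := by
  rw [hardyOp_apply, enorm_smul, Real.enorm_of_nonneg (hardyWeight_nonneg β x)]

lemma enorm_hardyOp_le (f : ProdSpace n → 𝕜) (x : ProdSpace n) :
    ‖hardyOp β f x‖ₑ ≤ ∫⁻ y, (∏ i, hardyKernel (β i / n i) (x i) (y i)) * ‖f y‖ₑ := by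
  rw [enorm_hardyOp, lintegral_prod_hardyKernel_mul]
  gcongr
  exact enorm_integral_le_lintegral_enorm _

lemma enorm_ofReal_of_nonneg {t : ℝ} (ht : 0 ≤ t) : ‖(t : 𝕜)‖ₑ = ENNReal.ofReal t := by
  rw [← ofReal_norm, RCLike.norm_ofReal, abs_of_nonneg ht]

lemma enorm_hardyOp_ofReal {f : ProdSpace n → ℝ} (hf : 0 ≤ f) {x : ProdSpace n}
    (hfi : IntegrableOn f (polyBall x) volume) :
    ‖hardyOp β (fun y => (f y : 𝕜)) x‖ₑ =
      ∫⁻ y, (∏ i, hardyKernel (β i / n i) (x i) (y i)) * ENNReal.ofReal (f y) := by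
  rw [enorm_hardyOp, lintegral_prod_hardyKernel_mul, integral_ofReal,
    ← ofReal_integral_eq_lintegral_ofReal hfi (ae_of_all _ hf),
    enorm_ofReal_of_nonneg (integral_nonneg hf)]

lemma measurable_hardyWeight (hn : ∀ i, 0 < n i) (β : Fin m → ℝ) :
    Measurable (hardyWeight β : ProdSpace n → ℝ) :=
  Finset.measurable_prod _ fun i _ =>
    (((measurable_ballVol (hn i)).comp (measurable_pi_apply i)).pow_const _).const_div 1

lemma measurableSet_setOf_mem_polyBall :
    MeasurableSet {z : ProdSpace n × ProdSpace n | z.2 ∈ polyBall z.1} := by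
  simp only [polyBall, mem_univ_pi, mem_ball_zero_iff, ofPred_forall]
  exact MeasurableSet.iInter fun i => measurableSet_lt (by fun_prop) (by fun_prop)

lemma stronglyMeasurable_setIntegral_polyBall {f : ProdSpace n → 𝕜} (hf : StronglyMeasurable f) :
    StronglyMeasurable fun x => ∫ y in polyBall x, f y := by
  have hind : StronglyMeasurable (uncurry fun x y : ProdSpace n =>
      (polyBall x).indicator f y) :=
    (hf.comp_measurable (measurable_snd (α := ProdSpace n))).indicator
      measurableSet_setOf_mem_polyBall
  simpa only [integral_indicator (measurableSet_polyBall _)] using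
    hind.integral_prod_right (ν := volume)

lemma aestronglyMeasurable_hardyOp (hn : ∀ i, 0 < n i) {f : ProdSpace n → 𝕜}
    (hf : AEStronglyMeasurable f volume) : AEStronglyMeasurable (hardyOp β f) volume := by
  rw [hardyOp_congr hf.ae_eq_mk]
  exact (measurable_hardyWeight hn β).aestronglyMeasurable.smul
    (stronglyMeasurable_setIntegral_polyBall hf.stronglyMeasurable_mk).aestronglyMeasurable

end HardyOp

section BlissConst

variable {m : ℕ} {n : Fin m → ℕ} {β : Fin m → ℝ} {q r : ℝ}

/-- The best constant in Bliss' inequality between the `L^q` and the `L^{q/(r+1)}` norms, that is,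
one factor of `hardyConst`. -/
noncomputable def blissConst (q r : ℝ) : ℝ :=
  (1 / (q - r - 1)) ^ (1 / q) * blissMass q r ^ (-(r / q))

lemma blissConst_nonneg (hr : 0 < r) (hq : r + 1 < q) : 0 ≤ blissConst q r := by
  have := blissMass_pos hr (by linarith : 1 < q)
  have : 0 < q - r - 1 := by linarith
  unfold blissConst
  positivity

lemma blissConst_eq_rpow (hr : 0 < r) (hq : r + 1 < q) :
    blissConst q r = (blissMass q r ^ (-r) / (q - r - 1)) ^ (1 / q) := by
  have hmass := blissMass_pos hr (by linarith : 1 < q)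
  have hq1 : 0 < q - r - 1 := by linarith
  rw [div_eq_mul_one_div, Real.mul_rpow (by positivity) (by positivity),
    ← Real.rpow_mul hmass.le, neg_mul, mul_one_div, mul_comm, blissConst]

lemma blissConst_mul_rpow (hr : 0 < r) (hq : r + 1 < q) :
    blissConst q r * blissMass q r ^ ((r + 1) / q) = (blissMass q r / (q - r - 1)) ^ (1 / q) := by
  have hmass := blissMass_pos hr (by linarith : 1 < q)
  have hq1 : 0 < q - r - 1 := by linarith
  have hexp : -(r / q) + (r + 1) / q = 1 / q := by ring
  rw [blissConst, mul_assoc, ← Real.rpow_add hmass, hexp, div_eq_mul_one_div (blissMass q r),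
    Real.mul_rpow hmass.le (by positivity), mul_comm]

theorem hardyConst_eq_blissConst_pow (hn : ∀ i, 0 < n i) (hr : 0 < r) (hq : r + 1 < q)
    (hβ : ∀ i, β i / n i = r / q) : hardyConst n β (q / (r + 1)) q = blissConst q r ^ m := by
  have hq0 : 0 < q := by linarith
  have hq1 : q - 1 ≠ 0 := by linarith
  rw [hardyConst, ← Fin.prod_const]
  refine Finset.prod_congr rfl fun i _ => ?_
  have hni : (0 : ℝ) < n i := Nat.cast_pos.2 (hn i)
  have hβi : β i = n i * r / q := by rw [mul_div_assoc, ← hβ i, mul_div_cancel₀ _ hni.ne']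
  have hz : (n i : ℝ) / (q * β i) = 1 / r := by
    rw [hβi]
    field_simp
  have hw : (n i : ℝ) / (q.conjExponent * β i) = (q - 1) / r := by
    rw [hβi, Real.conjExponent]
    field_simp
  have hp : (q / (r + 1)).conjExponent / q = 1 / (q - r - 1) := by
    rw [Real.conjExponent, ← (holderConjugate_div hr hq).conjugate_eq,
      div_div_cancel_left' hq0.ne', one_div]
  rw [hz, hw, hp, hβ i, ← blissMass_eq_eulerBeta hr, blissConst]

lemma exists_bliss_parameter {p : ℝ} (hp : 1 < p) (hpq : p < q)
    (hscale : ∀ i, 1 / q = 1 / p - β i / (n i : ℝ)) :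
    ∃ r, 0 < r ∧ r + 1 < q ∧ p = q / (r + 1) ∧ ∀ i, β i / n i = r / q := by
  have hp0 : 0 < p := one_pos.trans hp
  have hq0 : 0 < q := hp0.trans hpq
  refine ⟨q / p - 1, sub_pos.2 ((one_lt_div hp0).2 hpq), ?_, ?_, fun i => ?_⟩
  · rw [sub_add_cancel]
    exact div_lt_self hq0 hp
  · rw [sub_add_cancel, div_div_cancel₀ hq0.ne']
  · rw [sub_div, div_div_cancel_left' hq0.ne', ← one_div, hscale i, one_div]
    ring

end BlissConst

section HardyNorm

variable {𝕜 : Type*} [RCLike 𝕜] {m : ℕ} {n : Fin m → ℕ} {β : Fin m → ℝ} {q r : ℝ}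

theorem eLpNorm_hardyOp_le (hn : ∀ i, 0 < n i) (hr : 0 < r) (hq : r + 1 < q)
    (hβ : ∀ i, β i / n i = r / q) {f : ProdSpace n → 𝕜} (hf : AEStronglyMeasurable f volume) :
    eLpNorm (hardyOp β f) (ENNReal.ofReal q) volume ≤ ENNReal.ofReal (blissConst q r ^ m) *
      eLpNorm f (ENNReal.ofReal (q / (r + 1))) volume := by
  have hq0 : 0 < q := by linarith
  have hp0 : 0 < q / (r + 1) := by positivity
  have hK := HasKernelBound.pi hp0 (div_le_self hq0.le (by linarith))
    (fun i => measurable_hardyKernel (hn i) (r / q))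
    fun i => hasKernelBound_hardyKernel (hn i) hr hq
  have hconst : (∏ _i : Fin m, ENNReal.ofReal (blissMass q r ^ (-r) / (q - r - 1))) ^ (1 / q) =
      ENNReal.ofReal (blissConst q r ^ m) := by
    have := blissMass_pos hr (by linarith : 1 < q)
    have : 0 < q - r - 1 := by linarith
    rw [Fin.prod_const, ENNReal.ofReal_pow (blissConst_nonneg hr hq), blissConst_eq_rpow hr hq,
      ← ENNReal.ofReal_rpow_of_nonneg (by positivity) (by positivity), ← ENNReal.rpow_natCast,
      ← ENNReal.rpow_natCast, ← ENNReal.rpow_mul, ← ENNReal.rpow_mul, mul_comm]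
  refine (hK.eLpNorm_le hp0 hq0 hf fun x => ?_).trans_eq (by rw [hconst, volume_pi])
  simpa only [hβ, volume_pi] using enorm_hardyOp_le (β := β) f x

theorem memLp_hardyOp (hn : ∀ i, 0 < n i) (hr : 0 < r) (hq : r + 1 < q)
    (hβ : ∀ i, β i / n i = r / q) {f : ProdSpace n → 𝕜}
    (hf : MemLp f (ENNReal.ofReal (q / (r + 1))) volume) :
    MemLp (hardyOp β f) (ENNReal.ofReal q) volume :=
  ⟨aestronglyMeasurable_hardyOp hn hf.1, (eLpNorm_hardyOp_le hn hr hq hβ hf.1).trans_lt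
    (ENNReal.mul_lt_top ENNReal.ofReal_lt_top hf.2)⟩

/-- The tensor product of the extremal functions of Bliss' inequality. -/
noncomputable def hardyExtremal (r : ℝ) (y : ProdSpace n) : ℝ :=
  ∏ i, blissExtremal r (ballVol (y i))

lemma hardyExtremal_nonneg (r : ℝ) : 0 ≤ (hardyExtremal r : ProdSpace n → ℝ) :=
  fun y => Finset.prod_nonneg fun i _ => blissExtremal_nonneg (ballVol_nonneg (y i)) r

lemma ofReal_hardyExtremal (r : ℝ) (y : ProdSpace n) :
    ENNReal.ofReal (hardyExtremal r y) = ∏ i, ENNReal.ofReal (blissExtremal r (ballVol (y i))) :=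
  ENNReal.ofReal_prod_of_nonneg fun i _ => blissExtremal_nonneg (ballVol_nonneg (y i)) r

lemma measurable_hardyExtremal (hn : ∀ i, 0 < n i) (r : ℝ) :
    Measurable (hardyExtremal r : ProdSpace n → ℝ) :=
  Finset.measurable_prod _ fun i _ =>
    (measurable_blissExtremal r).comp ((measurable_ballVol (hn i)).comp (measurable_pi_apply i))

variable (𝕜)

lemma eLpNorm_hardyExtremal (hn : ∀ i, 0 < n i) (hr : 0 < r) (hq : r + 1 < q) :
    eLpNorm (fun y : ProdSpace n => (hardyExtremal r y : 𝕜)) (ENNReal.ofReal (q / (r + 1))) volume =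
      ENNReal.ofReal (blissMass q r ^ ((r + 1) / q)) ^ m := by
  have hq0 : 0 < q := by linarith
  have hp0 : 0 < q / (r + 1) := by positivity
  rw [eLpNorm_ofReal_exponent hp0]
  simp_rw [fun y : ProdSpace n => enorm_ofReal_of_nonneg (𝕜 := 𝕜) (hardyExtremal_nonneg r y),
    ofReal_hardyExtremal, ← ENNReal.prod_rpow_of_nonneg hp0.le]
  rw [volume_pi, lintegral_pi_prod (fun _ => volume)
    fun i => (measurable_ofReal_blissExtremal_ballVol (hn i) r).pow_const _]
  simp_rw [fun i => lintegral_blissExtremal_rpow (measurePreserving_ballVol (hn i)) hr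
    (by linarith : 1 < q)]
  rw [Fin.prod_const, ← ENNReal.ofReal_rpow_of_pos (blissMass_pos hr (by linarith)),
    ← ENNReal.rpow_natCast, ← ENNReal.rpow_natCast, ← ENNReal.rpow_mul, ← ENNReal.rpow_mul,
    one_div_div, mul_comm]

lemma memLp_hardyExtremal (hn : ∀ i, 0 < n i) (hr : 0 < r) (hq : r + 1 < q) :
    MemLp (fun y : ProdSpace n => (hardyExtremal r y : 𝕜)) (ENNReal.ofReal (q / (r + 1)))
      volume := by
  refine ⟨(RCLike.measurable_ofReal.comp (measurable_hardyExtremal hn r)).aestronglyMeasurable, ?_⟩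
  rw [eLpNorm_hardyExtremal 𝕜 hn hr hq]
  finiteness

lemma eLpNorm_hardyExtremal_ne_zero (hn : ∀ i, 0 < n i) (hr : 0 < r) (hq : r + 1 < q) :
    eLpNorm (fun y : ProdSpace n => (hardyExtremal r y : 𝕜)) (ENNReal.ofReal (q / (r + 1)))
      volume ≠ 0 := by
  rw [eLpNorm_hardyExtremal 𝕜 hn hr hq]
  have := blissMass_pos hr (by linarith : 1 < q)
  exact pow_ne_zero _ (ENNReal.ofReal_pos.2 (by positivity)).ne'

lemma enorm_hardyOp_hardyExtremal (hn : ∀ i, 0 < n i) (hr : 0 < r) (hq : r + 1 < q)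
    (x : ProdSpace n) :
    ‖hardyOp β (fun y : ProdSpace n => (hardyExtremal r y : 𝕜)) x‖ₑ =
      ∏ i, ∫⁻ y, hardyKernel (β i / n i) (x i) y *
        ENNReal.ofReal (blissExtremal r (ballVol y)) := by
  have hp1 : 1 ≤ ENNReal.ofReal (q / (r + 1)) :=
    ENNReal.one_le_ofReal.2 (holderConjugate_div hr hq).lt.le
  rw [enorm_hardyOp_ofReal (hardyExtremal_nonneg r)
    (integrableOn_polyBall hp1 (memLp_hardyExtremal ℝ hn hr hq) x)]
  simp_rw [ofReal_hardyExtremal, ← Finset.prod_mul_distrib]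
  exact lintegral_pi_prod (fun _ => volume) fun i =>
    (measurable_hardyKernel (hn i) _).of_uncurry_left.mul
      (measurable_ofReal_blissExtremal_ballVol (hn i) r)

theorem eLpNorm_hardyOp_hardyExtremal (hn : ∀ i, 0 < n i) (hr : 0 < r) (hq : r + 1 < q)
    (hβ : ∀ i, β i / n i = r / q) :
    eLpNorm (hardyOp β fun y : ProdSpace n => (hardyExtremal r y : 𝕜)) (ENNReal.ofReal q) volume =
      ENNReal.ofReal (blissConst q r ^ m) * eLpNorm (fun y : ProdSpace n =>
        (hardyExtremal r y : 𝕜)) (ENNReal.ofReal (q / (r + 1))) volume := by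
  have hq0 : 0 < q := by linarith
  have hq1 : 0 < q - r - 1 := by linarith
  have hmass := blissMass_pos hr (by linarith : 1 < q)
  have hmeas (i : Fin m) : Measurable fun x : EuclideanSpace ℝ (Fin (n i)) =>
      (∫⁻ y, hardyKernel (r / q) x y * ENNReal.ofReal (blissExtremal r (ballVol y))) ^ q :=
    (((measurable_hardyKernel (hn i) _).mul ((measurable_ofReal_blissExtremal_ballVol
      (hn i) r).comp measurable_snd)).lintegral_prod_right').pow_const _
  rw [eLpNorm_ofReal_exponent hq0, eLpNorm_hardyExtremal 𝕜 hn hr hq]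
  simp_rw [enorm_hardyOp_hardyExtremal 𝕜 hn hr hq, hβ, ← ENNReal.prod_rpow_of_nonneg hq0.le]
  rw [volume_pi, lintegral_pi_prod (fun _ => volume) hmeas]
  simp_rw [fun i => lintegral_lintegral_hardyKernel_mul_blissExtremal_rpow (hn i) hr hq]
  rw [Fin.prod_const, ENNReal.ofReal_pow (blissConst_nonneg hr hq), ← mul_pow,
    ← ENNReal.ofReal_mul (blissConst_nonneg hr hq), blissConst_mul_rpow hr hq,
    ← ENNReal.ofReal_rpow_of_pos (by positivity), ← ENNReal.rpow_natCast, ← ENNReal.rpow_natCast,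
    ← ENNReal.rpow_mul, ← ENNReal.rpow_mul, mul_comm]

theorem exists_hardyOp_continuousLinearMap [Fact (1 ≤ ENNReal.ofReal (q / (r + 1)))]
    [Fact (1 ≤ ENNReal.ofReal q)] (hn : ∀ i, 0 < n i) (hr : 0 < r) (hq : r + 1 < q)
    (hβ : ∀ i, β i / n i = r / q) :
    ∃ T : Lp 𝕜 (ENNReal.ofReal (q / (r + 1))) (volume : Measure (ProdSpace n)) →L[𝕜]
        Lp 𝕜 (ENNReal.ofReal q) (volume : Measure (ProdSpace n)),
      (∀ f, (T f : ProdSpace n → 𝕜) =ᵐ[volume] hardyOp β (f : ProdSpace n → 𝕜)) ∧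
      ‖T‖ = blissConst q r ^ m := by
  have hC : 0 ≤ blissConst q r ^ m := pow_nonneg (blissConst_nonneg hr hq) m
  have hint (f : Lp 𝕜 (ENNReal.ofReal (q / (r + 1))) (volume : Measure (ProdSpace n))) :
      ∀ x, IntegrableOn (f : ProdSpace n → 𝕜) (polyBall x) volume :=
    integrableOn_polyBall Fact.out (Lp.memLp f)
  obtain ⟨T, hT, hle⟩ := exists_continuousLinearMap_of_eLpNorm_le (𝕜 := 𝕜) hC
    (A := fun f : ProdSpace n → 𝕜 => hardyOp β f)
    (fun f => memLp_hardyOp hn hr hq hβ (Lp.memLp f))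
    (fun f g => .of_eq (by rw [hardyOp_congr (Lp.coeFn_add f g), hardyOp_add (hint f) (hint g)]))
    (fun c f => .of_eq (by rw [hardyOp_congr (Lp.coeFn_smul c f), hardyOp_const_smul]))
    (fun f => eLpNorm_hardyOp_le hn hr hq hβ (Lp.aestronglyMeasurable f))
  have hE := memLp_hardyExtremal 𝕜 hn hr hq
  refine ⟨T, hT, hle.antisymm (le_norm_of_eLpNorm_eq (f := hE.toLp) hC ?_ ?_)⟩
  · rw [eLpNorm_congr_ae hE.coeFn_toLp]
    exact eLpNorm_hardyExtremal_ne_zero 𝕜 hn hr hq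
  · rw [eLpNorm_congr_ae (hT _), hardyOp_congr hE.coeFn_toLp, eLpNorm_congr_ae hE.coeFn_toLp]
    exact eLpNorm_hardyOp_hardyExtremal 𝕜 hn hr hq hβ

theorem iSup_eLpNorm_hardyOp_div_eLpNorm (hn : ∀ i, 0 < n i) (hr : 0 < r) (hq : r + 1 < q)
    (hβ : ∀ i, β i / n i = r / q) :
    (⨆ (f : ProdSpace n → ℝ) (_ : 0 ≤ f) (_ : MemLp f (ENNReal.ofReal (q / (r + 1))) volume)
        (_ : eLpNorm f (ENNReal.ofReal (q / (r + 1))) volume ≠ 0),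
        eLpNorm (hardyOp β f) (ENNReal.ofReal q) volume /
          eLpNorm f (ENNReal.ofReal (q / (r + 1))) volume) =
      ENNReal.ofReal (blissConst q r ^ m) := by
  refine le_antisymm (iSup_le fun f => iSup_le fun _ => iSup_le fun hf => iSup_le fun _ =>
    ENNReal.div_le_of_le_mul (eLpNorm_hardyOp_le hn hr hq hβ hf.1)) ?_
  have hE : MemLp (hardyExtremal r : ProdSpace n → ℝ) _ volume := memLp_hardyExtremal ℝ hn hr hq
  have hE0 : eLpNorm (hardyExtremal r : ProdSpace n → ℝ) _ volume ≠ 0 :=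
    eLpNorm_hardyExtremal_ne_zero ℝ hn hr hq
  have hattained : eLpNorm (hardyOp β (hardyExtremal r : ProdSpace n → ℝ)) _ volume = _ :=
    eLpNorm_hardyOp_hardyExtremal ℝ hn hr hq hβ
  refine le_iSup_of_le (hardyExtremal r) (le_iSup_of_le (hardyExtremal_nonneg r)
    (le_iSup_of_le hE (le_iSup_of_le hE0 ?_)))
  rw [hattained]
  exact (ENNReal.mul_div_cancel_right hE0 hE.2.ne).ge

end HardyNorm

end

theorem theorem1 (𝕜 : Type*) [RCLike 𝕜] (m : ℕ) (n : Fin m → ℕ) (β : Fin m → ℝ) (p q : ℝ)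
    (hp : 1 < p) (hpq : p < q)
    (hβ : ∀ i, 0 < β i ∧ β i < (n i : ℝ))
    (hscale : ∀ i, 1 / q = 1 / p - β i / (n i : ℝ)) :
    -- the operator is well defined on `L^p`, maps it to `L^q`, and has bound `C`
    (∀ f : ProdSpace n → 𝕜, MemLp f (ENNReal.ofReal p) volume →
      (∀ x : ProdSpace n, IntegrableOn f (polyBall x) volume) ∧
      MemLp (hardyOp β f) (ENNReal.ofReal q) volume ∧
      eLpNorm (hardyOp β f) (ENNReal.ofReal q) volume ≤
        ENNReal.ofReal (hardyConst n β p q) * eLpNorm f (ENNReal.ofReal p) volume) ∧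
    -- as a bounded linear operator from `L^p` to `L^q` its operator norm is `C`
    (∃ (_ : Fact (1 ≤ ENNReal.ofReal p)) (_ : Fact (1 ≤ ENNReal.ofReal q))
      (T : Lp 𝕜 (ENNReal.ofReal p) (volume : Measure (ProdSpace n)) →L[𝕜]
        Lp 𝕜 (ENNReal.ofReal q) (volume : Measure (ProdSpace n))),
      (∀ f : Lp 𝕜 (ENNReal.ofReal p) (volume : Measure (ProdSpace n)),
        (T f : ProdSpace n → 𝕜) =ᵐ[volume] hardyOp β (f : ProdSpace n → 𝕜)) ∧
      ‖T‖ = hardyConst n β p q) ∧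
    -- on the non-negative functions of `L^p` the supremum of the quotients is `C` as well
    (⨆ (f : ProdSpace n → ℝ) (_ : 0 ≤ f) (_ : MemLp f (ENNReal.ofReal p) volume)
        (_ : eLpNorm f (ENNReal.ofReal p) volume ≠ 0),
        eLpNorm (hardyOp β f) (ENNReal.ofReal q) volume /
          eLpNorm f (ENNReal.ofReal p) volume) =
      ENNReal.ofReal (hardyConst n β p q) := by
  have hn (i : Fin m) : 0 < n i := Nat.cast_pos.1 ((hβ i).1.trans (hβ i).2)
  have hp1 : Fact (1 ≤ ENNReal.ofReal p) := ⟨ENNReal.one_le_ofReal.2 hp.le⟩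
  have hq1 : Fact (1 ≤ ENNReal.ofReal q) := ⟨ENNReal.one_le_ofReal.2 (hp.trans hpq).le⟩
  obtain ⟨r, hr, hq, rfl, hβr⟩ := exists_bliss_parameter hp hpq hscale
  rw [hardyConst_eq_blissConst_pow hn hr hq hβr]
  exact ⟨fun f hf => ⟨integrableOn_polyBall hp1.out hf, memLp_hardyOp hn hr hq hβr hf,
      eLpNorm_hardyOp_le hn hr hq hβr hf.1⟩,
    ⟨hp1, hq1, exists_hardyOp_continuousLinearMap 𝕜 hn hr hq hβr⟩,
    iSup_eLpNorm_hardyOp_div_eLpNorm hn hr hq hβr⟩
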